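/- **Setting.** Let $\mathcal N$ be a non-empty ground set of $n$ elements, $f:2^{\mathcal N}\to\mathbb R_{\ge 0}$ submodular, and $\mathcal I\subseteq 2^{\mathcal N}$ a $k$-extendible system with $k\ge 1$: $\mathcal I$ is non-empty and closed under taking subsets, and whenever $A\subseteq B\in\mathcal I$, $u\notin B$ and $A+u\in\mathcal I$, there is $Y\subseteq B\setminus A$ with $|Y|\le k$ and $(B\setminus Y)+u\in\mathcal I$. Let $c_1,\dots,c_m:\mathcal N\to\mathbb R_{\ge0}$ ($m\ge 0$) be knapsack weights, $c_r(S)=\sum_{u\in S}c_r(u)$. A set $S$ is feasible if $S\in\mathcal I$ and $c_r(S)\le 1$ for all $r$; all singletons are assumed feasible. Let $OPT$ be a feasible set maximizing $f$. The algorithm accesses $f$ and $\mathcal I$ only through a value oracle and an independence oracle. Write $f(u\mid S)=f(S+u)-f(S)$ and $\Delta_f=\max_{u\in\mathcal N} f(\{u\})$. **KnapsackSGS**$(\ell,\rho,\varepsilon)$. Start with $S^{(1)}=\dots=S^{(\ell)}=\varnothing$, all elements available, and $\tau=\Delta_f$. While $\tau>(\varepsilon/n)\Delta_f$: go once through all pairs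 $(u,j)$, $u\in\mathcal N$, $1\le j\le\ell$, in an arbitrary fixed order; for each pair such that $u$ is still available, $S^{(j)}+u\in\mathcal I$ and $f(u\mid S^{(j)})\ge\max(\tau,\rho\sum_r c_r(u))$, perform the knapsack check "$c_r(S^{(j)}+u)\le 1$ for all $r$"; if it succeeds, add $u$ to $S^{(j)}$ and make $u$ unavailable. Then set $\tau\leftarrow(1-\varepsilon)\tau$. Return a set of maximum value among $S^{(1)},\dots,S^{(\ell)}$ and the singletons, and the indicator $E\in\{0,1\}$ of the event that some knapsack check failed. **DensitySearchSGS**$(\ell,\delta,\varepsilon,\beta)$. Start with $k_\ell=1$, $k_u=\lceil\frac1\delta\log_2 n\rceil$. While $|k_u-k_\ell|>1$: let $k'=\lceil (k_\ell+k_u)/2\rceil$ and call KnapsackSGS with $\rho=\beta\Delta_f(1+\delta)^{k'}$; if $E=1$ set $k_\ell\leftarrow k'$, and if $E=0$ set $k_u\leftarrow k'$. Finally call KnapsackSGS with $\rho=\beta\Delta_f(1+\delta)^{k_\ell}$, and return a set of maximum value among all sets obtained. **Theorem.** Let $M=\max(\lceil\sqrt{1+2m}\,\rceil,k)$, $\varepsilon=\delta\in(0,1/2)$,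 and $p=\max(k,\ell-1)$. 1. If $\ell=M+1$ and $\beta=2(1-\varepsilon)\frac{1-\ell^{-1}-\varepsilon}{p+1+2m}$, then DensitySearchSGS halts after $\tilde O(Mn/\varepsilon)$ oracle calls and $\tilde O(M\max(m,1)\,n/\varepsilon)$ arithmetic operations on real numbers, $\tilde O(Mmn/\varepsilon)$ of which arise from the knapsack constraints (computing $\rho\sum_r c_r(u)$ and performing the knapsack checks), and it returns a feasible set $S$ with $$f(OPT)\le(1-2\varepsilon)^{-3}\Bigl[\max\Bigl\{k+\tfrac{2m+1}{k},\,1+2\sqrt{2m+1}\Bigr\}+2m+2\Bigr]f(S).$$ 2. If $f$ is in addition monotone, $1\le\ell\le k+1$ and $\beta=2(1-\varepsilon)\frac{1-\varepsilon}{p+1+2m}$, then DensitySearchSGS halts within the same bounds on oracle calls and arithmetic operations, and it returns a feasible set $S$ with $$f(OPT)\le(1-\varepsilon)^{-3}(k+2m+1)\,f(S).$$ Here $\tilde O(X)$ stands for a bound $C\cdot(\log(n/\varepsilon))^d\cdot X$ with absolute constants $C$ and $d$. -/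

import Mathlib

universe u v w

/-! ### The optimization problem -/

/-- A set function is submodular if `f (X ∪ Y) + f (X ∩ Y) ≤ f X + f Y` for all `X`, `Y`. -/
def IsSubmodular {α : Type u} [DecidableEq α] (f : Finset α → ℝ) : Prop :=
  ∀ X Y : Finset α, f (X ∪ Y) + f (X ∩ Y) ≤ f X + f Y

/-- An independence system: a non-empty, downward closed family of sets. -/
structure IsIndepSystem {α : Type u} (I : Set (Finset α)) : Prop where
  nonempty : I.Nonempty
  down_closed : ∀ A B : Finset α, A ⊆ B → B ∈ I → A ∈ I

/-- A `k`-extendible system: if `A ⊆ B` are independent, `x ∉ B` and `A + x` is independent, then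
`x` can be added to `B` after removing at most `k` elements of `B \ A`. -/
structure IsExtendible {α : Type u} [DecidableEq α] (k : ℕ) (I : Set (Finset α)) : Prop
    extends IsIndepSystem I where
  exchange : ∀ A B : Finset α, A ⊆ B → A ∈ I → B ∈ I → ∀ x : α, x ∉ B → insert x A ∈ I →
    ∃ Y : Finset α, Y ⊆ B \ A ∧ Y.card ≤ k ∧ insert x (B \ Y) ∈ I

/-- A feasible solution: an independent set that obeys the `m` knapsack constraints. -/
def IsFeasible {α : Type u} {m : ℕ} (I : Set (Finset α)) (c : Fin m → α → ℝ)
    (S : Finset α) : Prop :=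
  S ∈ I ∧ ∀ r : Fin m, ∑ x ∈ S, c r x ≤ 1

/-! ### Oracle programs and their cost -/

/-- What is charged for: value oracle calls, independence oracle calls, arithmetic operations on
reals (additions, subtractions, multiplications, divisions, comparisons) that arise from the
knapsack constraints, and all other arithmetic operations on reals. -/
structure Cost where
  value : ℕ
  indep : ℕ
  knap : ℕ
  other : ℕ

/-- The total number of oracle calls. -/
def Cost.oracle (q : Cost) : ℕ := q.value + q.indep

/-- The total number of arithmetic operations. -/
def Cost.arith (q : Cost) : ℕ := q.knap + q.other

/-- Programs over the ground set `α` with result in `X`.  The objective and the independence system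
are accessible only through the query nodes `value` and `indep`.  The nodes `knapOps t` and
`otherOps t` charge `t` arithmetic operations.  `diverge` is a computation without result. -/
inductive Prog (α : Type u) (X : Type v) : Type (max u v) where
  | ret (x : X) : Prog α X
  | diverge : Prog α X
  | value (S : Finset α) (next : ℝ → Prog α X) : Prog α X
  | indep (S : Finset α) (next : Bool → Prog α X) : Prog α X
  | knapOps (t : ℕ) (next : Prog α X) : Prog α X
  | otherOps (t : ℕ) (next : Prog α X) : Prog α X

namespace Prog

variable {α : Type u} {X : Type v} {Y : Type w}

/-- Sequential composition. -/
def bind : Prog α X → (X → Prog α Y) → Prog α Y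
  | ret x, g => g x
  | diverge, _ => diverge
  | value S next, g => value S fun a => (next a).bind g
  | indep S next, g => indep S fun b => (next b).bind g
  | knapOps t next, g => knapOps t (next.bind g)
  | otherOps t next, g => otherOps t (next.bind g)

open Classical in
/-- Executing a program with value oracle `f` and independence oracle `I`: the result together with
the cost, or `none` if the program diverges. -/
noncomputable def run (f : Finset α → ℝ) (I : Set (Finset α)) : Prog α X → Option (X × Cost)
  | ret x => some (x, ⟨0, 0, 0, 0⟩)
  | diverge => none
  | value S next =>
      ((next (f S)).run f I).map fun p => (p.1, { p.2 with value := p.2.value + 1 })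
  | indep S next =>
      ((next (decide (S ∈ I))).run f I).map fun p => (p.1, { p.2 with indep := p.2.indep + 1 })
  | knapOps t next => (next.run f I).map fun p => (p.1, { p.2 with knap := p.2.knap + t })
  | otherOps t next => (next.run f I).map fun p => (p.1, { p.2 with other := p.2.other + t })

/-- `while cond s do s ← body s`, cut off (with divergence) after `fuel` evaluations of `cond`. -/
def whileLoop (cond : X → Prog α Bool) (body : X → Prog α X) : ℕ → X → Prog α X
  | 0, _ => diverge
  | fuel + 1, s =>
      (cond s).bind fun b => if b then (body s).bind (whileLoop cond body fuel) else ret s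

/-- The computation `P`, whose loops are cut off after `fuel` rounds in `P fuel`, halts with result
`x` and cost `q`: every sufficiently large cut-off yields `x` at cost `q`. -/
def Halts (f : Finset α → ℝ) (I : Set (Finset α)) (P : ℕ → Prog α X) (x : X) (q : Cost) : Prop :=
  ∃ N : ℕ, ∀ fuel : ℕ, N ≤ fuel → (P fuel).run f I = some (x, q)

/-- Scans a list for a set of larger value than the best set `S` found so far, of value `a`. -/
noncomputable def argmaxFrom : Finset α → ℝ → List (Finset α) → Prog α (Finset α)
  | S, _, [] => ret S
  | S, a, T :: L => value T fun b => otherOps 1 <|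
      if a < b then argmaxFrom T b L else argmaxFrom S a L

/-- A set of maximum value in a (non-empty) list of sets. -/
noncomputable def argmax : List (Finset α) → Prog α (Finset α)
  | [] => ret ∅
  | S :: L => value S fun a => argmaxFrom S a L

/-- The maximum of `a` and of the values of the singletons of a list of elements. -/
noncomputable def maxSingletonFrom : ℝ → List α → Prog α ℝ
  | a, [] => ret a
  | a, x :: L => value {x} fun b => otherOps 1 (maxSingletonFrom (max a b) L)

/-- The maximum value of a singleton, over a (non-empty) list of elements. -/
noncomputable def maxSingleton : List α → Prog α ℝ
  | [] => ret 0
  | x :: L => value {x} fun a => maxSingletonFrom a L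

end Prog

/-! ### The simultaneous greedy subroutine with a density threshold -/

/-- The state of `knapsackSGS`: the `ℓ` current solutions, their loads in the `m` knapsacks, the
elements that are still available, and whether the knapsack check has ever failed. -/
structure SGSState (α : Type u) (ℓ m : ℕ) where
  sol : Fin ℓ → Finset α
  load : Fin ℓ → Fin m → ℝ
  avail : Finset α
  rejected : Bool

section Algorithms

variable {α : Type u} [DecidableEq α] {ℓ m : ℕ}

/-- Treat the element-solution pair `(x, j)` at marginal threshold `τ` and density threshold `ρ`:
if `x` is available, `S_j + x` is independent and `f (x | S_j) ≥ max τ (∑ r, ρ * c_r x)`, then add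
`x` to `S_j` if this respects all knapsacks, and record a rejection otherwise. -/
noncomputable def tryPair (c : Fin m → α → ℝ) (ρ τ : ℝ) (st : SGSState α ℓ m) (x : α) (j : Fin ℓ) :
    Prog α (SGSState α ℓ m) :=
  if x ∈ st.avail then
    .indep (insert x (st.sol j)) fun b =>
      if b then
        .value (insert x (st.sol j)) fun a => .value (st.sol j) fun a' =>
          -- `m` multiplications and `m` additions; a subtraction, a maximum, a comparison
          .knapOps (2 * m) <| .otherOps 3 <|
            if max τ (∑ r, ρ * c r x) ≤ a - a' then
              -- `m` additions and `m` comparisons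
              .knapOps (2 * m) <|
                if ∀ r, st.load j r + c r x ≤ 1 then
                  .ret { sol := Function.update st.sol j (insert x (st.sol j))
                         load := Function.update st.load j fun r => st.load j r + c r x
                         avail := st.avail.erase x
                         rejected := st.rejected }
                else .ret { st with rejected := true }
            else .ret st
      else .ret st
  else .ret st

/-- One pass over a list of element-solution pairs. -/
noncomputable def scanPairs (c : Fin m → α → ℝ) (ρ τ : ℝ) :
    List (α × Fin ℓ) → SGSState α ℓ m → Prog α (SGSState α ℓ m)
  | [], st => .ret st
  | p :: L, st => (tryPair c ρ τ st p.1 p.2).bind (scanPairs c ρ τ L)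

variable [Fintype α]

/-- The simultaneous greedy procedure with density threshold `ρ`.  The marginal threshold `τ` starts
at `Δ`, the maximum value of a singleton, and is multiplied by `1 - ε` after each pass over all
element-solution pairs (in the order `pairs`), as long as `τ > (ε / n) * Δ`.  It returns a best set
among the `ℓ` solutions and the singletons, and whether the knapsack check ever failed. -/
noncomputable def knapsackSGS (c : Fin m → α → ℝ) (pairs : List (α × Fin ℓ)) (ρ ε : ℝ)
    (fuel : ℕ) : Prog α (Finset α × Bool) :=
  (Prog.maxSingleton (Finset.univ : Finset α).toList).bind fun Δ =>
    (Prog.whileLoop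
      (fun s : ℝ × SGSState α ℓ m =>
        .otherOps 3 <| .ret (decide (ε / (Fintype.card α : ℝ) * Δ < s.1)))
      (fun s => (scanPairs c ρ s.1 pairs s.2).bind fun st =>
        .otherOps 2 <| .ret ((1 - ε) * s.1, st))
      fuel
      (Δ, { sol := fun _ => ∅, load := fun _ _ => 0, avail := Finset.univ,
            rejected := false })).bind fun s =>
      (Prog.argmax (List.ofFn s.2.sol ++
        (Finset.univ : Finset α).toList.map fun x => {x})).bind fun S =>
          .ret (S, s.2.rejected)

/-- The state of `densitySearchSGS`: lower and upper bounds of the binary search over the exponents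
of the grid, and the sets found so far. -/
structure SearchState (α : Type u) where
  lo : ℕ
  hi : ℕ
  found : List (Finset α)

/-- Binary search for a density threshold `β * Δ * (1 + δ) ^ i`, `1 ≤ i ≤ ⌈(log₂ n) / δ⌉`.  If the
knapsack check failed in the call of `knapsackSGS` then the search goes on with larger thresholds,
otherwise with smaller ones.  (The middle exponent `(lo + hi + 1) / 2` is `⌈(lo + hi) / 2⌉`, and
the threshold with exponent `i` is charged at most `i + 3` operations.) -/
noncomputable def densitySearchSGS (c : Fin m → α → ℝ) (pairs : List (α × Fin ℓ)) (δ ε β : ℝ)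
    (fuel : ℕ) : Prog α (Finset α) :=
  (Prog.maxSingleton (Finset.univ : Finset α).toList).bind fun Δ =>
    (Prog.whileLoop
      (fun s : SearchState α => .ret (decide (1 < |(s.hi : ℤ) - (s.lo : ℤ)|)))
      (fun s =>
        let i := (s.lo + s.hi + 1) / 2
        .otherOps (i + 3) <|
          (knapsackSGS c pairs (β * Δ * (1 + δ) ^ i) ε fuel).bind fun out =>
            if out.2 then .ret { lo := i, hi := s.hi, found := out.1 :: s.found }
            else .ret { lo := s.lo, hi := i, found := out.1 :: s.found })
      fuel
      { lo := 1, hi := ⌈Real.logb 2 (Fintype.card α : ℝ) / δ⌉₊, found := [] }).bind fun s =>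
        .otherOps (s.lo + 3) <|
          (knapsackSGS c pairs (β * Δ * (1 + δ) ^ s.lo) ε fuel).bind fun out =>
            Prog.argmax (out.1 :: s.found)

end Algorithms

/-! ### Parameters and cost bounds -/

/-- The number `M = max(⌈√(1 + 2 m)⌉, k)`. -/
noncomputable def numM (k m : ℕ) : ℕ := max ⌈Real.sqrt (1 + 2 * (m : ℝ))⌉₊ k

/-- The input `β` for general objectives, where `p = max(k, ℓ - 1)`. -/
noncomputable def betaGeneral (k m ℓ : ℕ) (ε : ℝ) : ℝ :=
  2 * (1 - ε) * ((1 - 1 / (ℓ : ℝ) - ε) / (max (k : ℝ) ((ℓ : ℝ) - 1) + 1 + 2 * (m : ℝ)))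

/-- The input `β` for monotone objectives, where `p = max(k, ℓ - 1)`. -/
noncomputable def betaMonotone (k m ℓ : ℕ) (ε : ℝ) : ℝ :=
  2 * (1 - ε) * ((1 - ε) / (max (k : ℝ) ((ℓ : ℝ) - 1) + 1 + 2 * (m : ℝ)))

/-- With `L = C * (log (n / ε)) ^ d`: at most `L * M * n / ε` oracle calls, at most
`L * M * m * n / ε` arithmetic operations that arise from the knapsack constraints, and at most
`L * M * max(m, 1) * n / ε` arithmetic operations in total. -/
def CostBound (C : ℝ) (d n k m : ℕ) (ε : ℝ) (q : Cost) : Prop :=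
  (q.oracle : ℝ) ≤ C * Real.log (n / ε) ^ d * ((numM k m : ℝ) * n / ε) ∧
  (q.knap : ℝ) ≤ C * Real.log (n / ε) ^ d * ((numM k m : ℝ) * m * n / ε) ∧
  (q.arith : ℝ) ≤ C * Real.log (n / ε) ^ d * ((numM k m : ℝ) * (max m 1 : ℕ) * n / ε)

/-!
All costs and guarantees of the programs are derived in a small program logic: `Prog.Ensures f I P R b`
says that `P` halts, that its result satisfies `R`, and that its cost is within the budget `b`.  Since
raising the cut-off of a loop never changes a result (`Prog.RunLE`), a specification for one cut-off
describes the outcome of the computation.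

Consider one run of `knapsackSGS` with density threshold `ρ`, returning `S`, and let `T` be feasible.

* If a knapsack check failed for `x` and `S_j`, then `S_j + x` overfills a knapsack, and each of its
  elements has contributed at least its density threshold, so `ρ ≤ f (S_j + x) ≤ 2 f S`
  (`SGSInv.fail`).
* If no check failed, then the elements of `T` are charged to the added elements
  (`Remainder.exists_insert`, `SGSInv.add`).  For each `j` a set `O j ⊆ T` is maintained that can still
  be added to `S_j` as a whole.  When `x` is added to `S_j`, extendibility discards at most `k` elements
  of `O j`; if `x ∈ T`, then `x` is discarded from the `ℓ - 1` other sets.  Both never happen together,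
  because the exchange is made relative to the final solution, whose intersection with `T` is kept in
  `O j` from the start.  Hence an addition pays for `p = max k (ℓ - 1)` elements, and a discarded element
  had failed the previous threshold, so that its marginal is at most `1 / (1 - ε)` times the current
  gain, up to its density threshold.  The elements never discarded have small marginals in the end.
  Summation gives `a * f T ≤ (p + 1) / (1 - ε) * f S + ρ * m` (`SGSInv.le_of_not_rejected`), where
  `a * f T` is a lower bound for the average of the values `f (T ∪ S_j)`: `a = 1` for monotone `f`, and
  `a = 1 - 1 / ℓ` in general, by disjointness of the solutions (`IsSubmodular.le_sum_union`).

The two bounds balance at `ρ = β * f T`.  As `f T` is between `Δ` and `n * Δ` (or else `f T ≤ f S`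
already), the grid of thresholds covers this value, and the binary search ends with two adjacent
thresholds, one of which is within a factor `1 + ε` and falls under the bound that is favourable there
(`SearchInv.le_of_exit`).

For the costs, `(1 - ε) ^ P ≤ ε / n` holds after `P = ⌈log (n / ε) / ε⌉` passes, and the binary search
among `K` exponents takes at most `⌈log₂ K⌉` rounds (`costBound_of_spent_le`).
-/

/-! ### A program logic with budgets -/

/-- Componentwise addition of costs. -/
instance : Add Cost :=
  ⟨fun q r => ⟨q.value + r.value, q.indep + r.indep, q.knap + r.knap, q.other + r.other⟩⟩

/-- The oracle calls, knapsack operations and other operations of a cost, as a triple that can be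
compared and added componentwise. -/
def Cost.spent (q : Cost) : ℕ × ℕ × ℕ := (q.oracle, q.knap, q.other)

theorem Cost.spent_add (q r : Cost) : (q + r).spent = q.spent + r.spent := by
  simp only [Cost.spent, Cost.oracle, HAdd.hAdd, Add.add, Prod.mk.injEq]
  simp only [Nat.add_eq, and_true]
  omega

namespace Prog

variable {α : Type u} {X : Type v} {Y : Type w} {f : Finset α → ℝ} {I : Set (Finset α)}

theorem run_bind (P : Prog α X) (g : X → Prog α Y) :
    (P.bind g).run f I =
      (P.run f I).bind fun p => ((g p.1).run f I).map fun r => (r.1, p.2 + r.2) := by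
  have key : ∀ (o : Option (X × Cost)) (t : Cost → Cost),
      (∀ q r : Cost, t q + r = t (q + r)) →
      ((o.bind fun p => ((g p.1).run f I).map fun r => (r.1, p.2 + r.2)).map
          fun p => (p.1, t p.2)) =
        (o.map fun p => (p.1, t p.2)).bind
          fun p => ((g p.1).run f I).map fun r => (r.1, p.2 + r.2) := by
    intro o t ht
    cases o with
    | none => rfl
    | some p => cases h : (g p.1).run f I <;> simp [h, ht]
  induction P with
  | ret x =>
    simp only [bind, run, Option.bind_some]
    cases h : (g x).run f I with
    | none => rfl
    | some r =>
      obtain ⟨y, q⟩ := r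
      simp only [Option.map_some, Option.some.injEq, Prod.mk.injEq, true_and]
      cases q
      simp only [HAdd.hAdd, Add.add, Cost.mk.injEq]
      simp
  | diverge => rfl
  | value S next ih =>
    simp only [bind, run, ih]
    refine key _ (fun q => { q with value := q.value + 1 }) fun q r => ?_
    simp only [HAdd.hAdd, Add.add, Cost.mk.injEq]
    simp only [Nat.add_eq, and_true]
    omega
  | indep S next ih =>
    simp only [bind, run, ih]
    refine key _ (fun q => { q with indep := q.indep + 1 }) fun q r => ?_
    simp only [HAdd.hAdd, Add.add, Cost.mk.injEq]
    simp only [Nat.add_eq, and_true, true_and]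
    omega
  | knapOps t next ih =>
    simp only [bind, run, ih]
    refine key _ (fun q => { q with knap := q.knap + t }) fun q r => ?_
    simp only [HAdd.hAdd, Add.add, Cost.mk.injEq]
    simp only [Nat.add_eq, and_true, true_and]
    omega
  | otherOps t next ih =>
    simp only [bind, run, ih]
    refine key _ (fun q => { q with other := q.other + t }) fun q r => ?_
    simp only [HAdd.hAdd, Add.add, Cost.mk.injEq]
    simp only [Nat.add_eq, true_and]
    omega

/-- The program `P` halts with a result that satisfies `R`, and its cost is at most the budget `b`
(oracle calls, knapsack operations, other operations). -/
def Ensures (f : Finset α → ℝ) (I : Set (Finset α)) (P : Prog α X) (R : X → Prop)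
    (b : ℕ × ℕ × ℕ) : Prop :=
  ∃ x q, P.run f I = some (x, q) ∧ R x ∧ q.spent ≤ b

theorem Ensures.mono {P : Prog α X} {R R' : X → Prop} {b b' : ℕ × ℕ × ℕ}
    (h : Ensures f I P R b) (hR : ∀ x, R x → R' x) (hb : b ≤ b') : Ensures f I P R' b' := by
  obtain ⟨x, q, h1, h2, h3⟩ := h
  exact ⟨x, q, h1, hR x h2, h3.trans hb⟩

theorem Ensures.bind {P : Prog α X} {g : X → Prog α Y} {R : X → Prop} {R' : Y → Prop}
    {b b' : ℕ × ℕ × ℕ} (h : Ensures f I P R b) (hg : ∀ x, R x → Ensures f I (g x) R' b') :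
    Ensures f I (P.bind g) R' (b + b') := by
  obtain ⟨x, q, h1, h2, h3⟩ := h
  obtain ⟨y, r, h4, h5, h6⟩ := hg x h2
  refine ⟨y, q + r, ?_, h5, ?_⟩
  · simp [run_bind, h1, h4]
  · rw [Cost.spent_add]
    exact add_le_add h3 h6

theorem Ensures.ret {x : X} {R : X → Prop} (h : R x) {b : ℕ × ℕ × ℕ} :
    Ensures f I (ret x) R b :=
  ⟨x, _, rfl, h, by simp [Cost.spent, Cost.oracle, Prod.le_def]⟩

theorem Ensures.value {S : Finset α} {next : ℝ → Prog α X} {R : X → Prop} {b : ℕ × ℕ × ℕ}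
    (h : Ensures f I (next (f S)) R b) : Ensures f I (value S next) R ((1, 0, 0) + b) := by
  obtain ⟨x, q, h1, h2, h3⟩ := h
  refine ⟨x, { q with value := q.value + 1 }, by simp only [run, h1, Option.map_some], h2, ?_⟩
  simp only [Cost.spent, Cost.oracle, Prod.le_def, Prod.fst_add, Prod.snd_add] at h3 ⊢
  omega

open Classical in
theorem Ensures.indep {S : Finset α} {next : Bool → Prog α X} {R : X → Prop} {b : ℕ × ℕ × ℕ}
    (h : Ensures f I (next (decide (S ∈ I))) R b) :
    Ensures f I (indep S next) R ((1, 0, 0) + b) := by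
  obtain ⟨x, q, h1, h2, h3⟩ := h
  refine ⟨x, { q with indep := q.indep + 1 }, by simp only [run, h1, Option.map_some], h2, ?_⟩
  simp only [Cost.spent, Cost.oracle, Prod.le_def, Prod.fst_add, Prod.snd_add] at h3 ⊢
  omega

theorem Ensures.knapOps {t : ℕ} {P : Prog α X} {R : X → Prop} {b : ℕ × ℕ × ℕ}
    (h : Ensures f I P R b) : Ensures f I (knapOps t P) R ((0, t, 0) + b) := by
  obtain ⟨x, q, h1, h2, h3⟩ := h
  refine ⟨x, { q with knap := q.knap + t }, by simp only [run, h1, Option.map_some], h2, ?_⟩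
  simp only [Cost.spent, Cost.oracle, Prod.le_def, Prod.fst_add, Prod.snd_add] at h3 ⊢
  omega

theorem Ensures.otherOps {t : ℕ} {P : Prog α X} {R : X → Prop} {b : ℕ × ℕ × ℕ}
    (h : Ensures f I P R b) : Ensures f I (otherOps t P) R ((0, 0, t) + b) := by
  obtain ⟨x, q, h1, h2, h3⟩ := h
  refine ⟨x, { q with other := q.other + t }, by simp only [run, h1, Option.map_some], h2, ?_⟩
  simp only [Cost.spent, Cost.oracle, Prod.le_def, Prod.fst_add, Prod.snd_add] at h3 ⊢
  omega

/-- The rule for loops.  In `Inv i s`, the number `i` bounds the rounds that are still to come when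
the loop is in state `s`. -/
theorem Ensures.whileLoop {cond : X → Prog α Bool} {body : X → Prog α X} (test : X → Bool)
    (Inv : ℕ → X → Prop) {R : X → Prop} {b b' : ℕ × ℕ × ℕ}
    (hcond : ∀ s, Ensures f I (cond s) (fun t => t = test s) b)
    (hbody : ∀ i s, Inv i s → test s = true →
      ∃ i', i = i' + 1 ∧ Ensures f I (body s) (Inv i') b')
    (hexit : ∀ i s, Inv i s → test s = false → R s)
    {i fuel : ℕ} {s : X} (hs : Inv i s) (hi : i < fuel) :
    Ensures f I (whileLoop cond body fuel s) R (i • (b + b') + b) := by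
  induction fuel generalizing i s with
  | zero => omega
  | succ fuel ih =>
    cases h : test s with
    | false =>
      refine Ensures.mono (Ensures.bind (b' := 0) (hcond s) fun t ht => ?_) (fun _ hx => hx)
        (b := b + 0) (by rw [add_zero]; exact le_add_of_nonneg_left zero_le)
      rw [ht, h]
      exact Ensures.ret (hexit i s hs h)
    | true =>
      obtain ⟨i, rfl, hb⟩ := hbody i s hs h
      refine Ensures.mono (Ensures.bind (hcond s) (b' := b' + (i • (b + b') + b))
        fun t ht => ?_) (fun _ hx => hx) (le_of_eq ?_)
      · rw [ht, h]
        exact Ensures.bind hb fun s' hs' => ih hs' (by omega)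
      · rw [succ_nsmul]
        abel

/-- Whenever `P` halts, `P'` halts with the same result at the same cost. -/
def RunLE (f : Finset α → ℝ) (I : Set (Finset α)) (P P' : Prog α X) : Prop :=
  ∀ r, P.run f I = some r → P'.run f I = some r

theorem RunLE.refl (P : Prog α X) : RunLE f I P P := fun _ h => h

theorem RunLE.bind {P P' : Prog α X} {g g' : X → Prog α Y} (h : RunLE f I P P')
    (hg : ∀ x, RunLE f I (g x) (g' x)) : RunLE f I (P.bind g) (P'.bind g') := by
  intro r hr
  rw [run_bind] at hr ⊢
  cases hp : P.run f I with
  | none => simp [hp] at hr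
  | some p =>
    rw [h p hp]
    rw [hp] at hr
    cases hq : (g p.1).run f I with
    | none => simp [hq] at hr
    | some q =>
      simp only [Option.bind_some, hq] at hr ⊢
      rw [hg _ q hq]
      exact hr

theorem RunLE.otherOps {P P' : Prog α X} (t : ℕ) (h : RunLE f I P P') :
    RunLE f I (otherOps t P) (otherOps t P') := by
  intro r hr
  simp only [run] at hr ⊢
  cases hp : P.run f I with
  | none => simp [hp] at hr
  | some p => rw [h p hp]; rwa [hp] at hr

theorem RunLE.whileLoop {cond : X → Prog α Bool} {body body' : X → Prog α X}
    (h : ∀ s, RunLE f I (body s) (body' s)) {fuel fuel' : ℕ} (hle : fuel ≤ fuel') (s : X) :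
    RunLE f I (whileLoop cond body fuel s) (whileLoop cond body' fuel' s) := by
  induction fuel generalizing fuel' s with
  | zero => intro r hr; simp [Prog.whileLoop, run] at hr
  | succ fuel ih =>
    obtain ⟨fuel', rfl⟩ : ∃ i, fuel' = i + 1 := ⟨fuel' - 1, by omega⟩
    refine RunLE.bind (RunLE.refl _) fun b => ?_
    cases b
    · exact RunLE.refl _
    · exact RunLE.bind (h s) fun s' => ih (by omega) s'

/-- If raising the cut-off preserves results, then a specification that holds for one cut-off
describes the outcome of the computation. -/
theorem Ensures.halts {P : ℕ → Prog α X} {R : X → Prop} {b : ℕ × ℕ × ℕ} {i : ℕ}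
    (hP : ∀ i' ≥ i, RunLE f I (P i) (P i')) (h : Ensures f I (P i) R b) :
    ∃ x q, Halts f I P x q ∧ R x ∧ q.spent ≤ b := by
  obtain ⟨x, q, h1, h2, h3⟩ := h
  exact ⟨x, q, ⟨i, fun i' hi => hP i' hi _ h1⟩, h2, h3⟩

/-! ### Maxima over lists -/

theorem argmaxFrom_ensures (L : List (Finset α)) (S : Finset α) :
    Ensures f I (argmaxFrom S (f S) L) (fun T => T ∈ S :: L ∧ ∀ T' ∈ S :: L, f T' ≤ f T)
      (L.length, 0, L.length) := by
  induction L generalizing S with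
  | nil => exact Ensures.ret (by simp)
  | cons T L ih =>
    refine Ensures.mono (Ensures.value (b := (0, 0, 1) + (L.length, 0, L.length))
      (Ensures.otherOps ?_)) (fun _ hx => hx)
      (by simp only [Prod.le_def, Prod.fst_add, Prod.snd_add, List.length_cons]; omega)
    split_ifs with h
    · refine (ih T).mono (fun U hU => ⟨by simp_all, fun T' hT' => ?_⟩) le_rfl
      rcases List.mem_cons.1 hT' with rfl | hT'
      · exact h.le.trans (hU.2 T (by simp))
      · exact hU.2 T' hT'
    · refine (ih S).mono (fun U hU => ⟨?_, fun T' hT' => ?_⟩) le_rfl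
      · have := hU.1
        simp only [List.mem_cons] at this ⊢
        tauto
      · simp only [List.mem_cons] at hT'
        rcases hT' with rfl | rfl | hT'
        · exact hU.2 _ (by simp)
        · exact (not_lt.1 h).trans (hU.2 S (by simp))
        · exact hU.2 T' (by simp [hT'])

theorem argmax_ensures {L : List (Finset α)} (hL : L ≠ []) :
    Ensures f I (argmax L) (fun T => T ∈ L ∧ ∀ T' ∈ L, f T' ≤ f T) (L.length, 0, L.length) := by
  cases L with
  | nil => exact absurd rfl hL
  | cons S L =>
    refine Ensures.mono (Ensures.value (argmaxFrom_ensures L S)) (fun _ hx => hx) ?_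
    simp only [Prod.le_def, Prod.fst_add, Prod.snd_add, List.length_cons]
    omega

theorem maxSingletonFrom_ensures (L : List α) (a : ℝ) :
    Ensures f I (maxSingletonFrom a L)
      (fun b => a ≤ b ∧ (∀ x ∈ L, f {x} ≤ b) ∧ (b = a ∨ ∃ x, b = f {x}))
      (L.length, 0, L.length) := by
  induction L generalizing a with
  | nil => exact Ensures.ret (by simp)
  | cons y L ih =>
    refine Ensures.mono (Ensures.value (Ensures.otherOps (ih (max a (f {y})))))
      (fun b hb => ⟨(le_max_left _ _).trans hb.1, ?_, ?_⟩)
      (by simp only [Prod.le_def, Prod.fst_add, Prod.snd_add, List.length_cons]; omega)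
    · intro x hx
      rcases List.mem_cons.1 hx with rfl | hx
      · exact (le_max_right _ _).trans hb.1
      · exact hb.2.1 x hx
    · rcases hb.2.2 with h | h
      · rcases max_choice a (f {y}) with h' | h'
        · exact Or.inl (h.trans h')
        · exact Or.inr ⟨y, h.trans h'⟩
      · exact Or.inr h

theorem maxSingleton_ensures {L : List α} (hL : ∀ x, x ∈ L) [Nonempty α] {Δ : ℝ}
    (hΔ : IsGreatest (Set.range fun x : α => f {x}) Δ) :
    Ensures f I (maxSingleton L) (fun b => b = Δ) (L.length, 0, L.length) := by
  cases L with
  | nil => exact absurd (hL (Classical.arbitrary α)) (by simp)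
  | cons y L =>
    refine Ensures.mono (Ensures.value (maxSingletonFrom_ensures L (f {y}))) (fun b hb => ?_)
      (by simp only [Prod.le_def, Prod.fst_add, Prod.snd_add, List.length_cons]; omega)
    refine IsGreatest.unique ⟨?_, ?_⟩ hΔ
    · rcases hb.2.2 with h | ⟨x, h⟩
      · exact ⟨y, h.symm⟩
      · exact ⟨x, h.symm⟩
    · rintro _ ⟨x, rfl⟩
      rcases List.mem_cons.1 (hL x) with rfl | hx
      · exact hb.1
      · exact hb.2.1 x hx

end Prog

/-! ### Submodular functions -/

section Submodular

variable {α : Type u} [DecidableEq α] {f : Finset α → ℝ}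

/-- The marginal value `f (x | S) = f (S + x) - f S`. -/
def marginal (f : Finset α → ℝ) (x : α) (S : Finset α) : ℝ := f (insert x S) - f S

theorem IsSubmodular.marginal_anti (hf : IsSubmodular f) {A B : Finset α} {x : α} (h : A ⊆ B)
    (hx : x ∉ B) : marginal f x B ≤ marginal f x A := by
  have h1 := hf (insert x A) B
  rw [Finset.insert_union, Finset.union_eq_right.2 h, Finset.insert_inter_of_notMem hx,
    Finset.inter_eq_left.2 h] at h1
  unfold marginal
  linarith

theorem IsSubmodular.union_le_add_sum_marginal (hf : IsSubmodular f) (S T : Finset α) :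
    f (T ∪ S) ≤ f S + ∑ x ∈ T \ S, marginal f x S := by
  suffices h : ∀ U : Finset α, Disjoint U S → f (U ∪ S) ≤ f S + ∑ x ∈ U, marginal f x S by
    have := h (T \ S) Finset.sdiff_disjoint
    rwa [Finset.sdiff_union_self_eq_union] at this
  intro U
  induction U using Finset.induction_on with
  | empty => simp
  | insert x U hx ih =>
    intro hd
    rw [Finset.disjoint_insert_left] at hd
    have h1 := ih hd.2
    have h2 : marginal f x (U ∪ S) ≤ marginal f x S :=
      hf.marginal_anti Finset.subset_union_right (by simp [hx, hd.1])
    rw [Finset.sum_insert hx, Finset.insert_union]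
    unfold marginal at h2 ⊢
    unfold marginal at h1
    linarith

theorem IsSubmodular.le_empty_add_sum (hf : IsSubmodular f) (T : Finset α) :
    f T ≤ f ∅ + ∑ x ∈ T, (f {x} - f ∅) := by
  simpa [marginal] using hf.union_le_add_sum_marginal ∅ T

/-- A set can lose little on average when it is united with disjoint sets, because the parts that
are lost to different sets add up. -/
theorem IsSubmodular.le_sum_union (hf : IsSubmodular f) (h0 : ∀ S, 0 ≤ f S) {ι : Type*}
    [Fintype ι] (T : Finset α) (S : ι → Finset α)
    (hS : ∀ i j, i ≠ j → Disjoint (S i) (S j)) :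
    ((Fintype.card ι : ℝ) - 1) * f T ≤ ∑ i, f (T ∪ S i) := by
  classical
  have key : ∀ s : Finset ι,
      ((s.card : ℝ) - 1) * f T + f (T ∪ s.biUnion S) ≤ ∑ i ∈ s, f (T ∪ S i) := by
    intro s
    induction s using Finset.induction_on with
    | empty => simp
    | insert i s hi ih =>
      rw [Finset.sum_insert hi, Finset.card_insert_of_notMem hi, Finset.biUnion_insert]
      have h1 := hf (T ∪ S i) (T ∪ s.biUnion S)
      have hd : Disjoint (S i) (s.biUnion S) := by
        rw [Finset.disjoint_biUnion_right]
        exact fun j hj => hS i j fun h => hi (h ▸ hj)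
      rw [← Finset.union_inter_distrib_left, Finset.disjoint_iff_inter_eq_empty.1 hd,
        Finset.union_empty, ← Finset.union_union_distrib_left] at h1
      push_cast
      linarith
  have := key Finset.univ
  rw [Finset.card_univ] at this
  linarith [h0 (T ∪ Finset.univ.biUnion S)]

end Submodular

/-! ### The exchange argument -/

section Exchange

variable {α : Type u} [DecidableEq α] {ℓ : ℕ} {f : Finset α → ℝ} {I : Set (Finset α)}

/-- Let `S` be the current and `F` the final solutions.  The sets `O j` are what is left of `T` when,
for each `j`, the elements that can no longer be added to `S j` together have been discarded; those
that `F j` contains are never discarded. -/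
structure Remainder (I : Set (Finset α)) (T : Finset α) (F S O : Fin ℓ → Finset α) : Prop where
  subset : ∀ j, O j ⊆ T
  keep : ∀ j, T ∩ F j ⊆ O j
  indep : ∀ j, S j ∪ O j ∈ I
  fresh : ∀ j j', j ≠ j' → Disjoint (O j) (S j')

/-- Adding `x` to the solution `S j` costs at most `max k (ℓ - 1)` discarded elements: if `x ∈ T` then
the other `ℓ - 1` remainders lose `x` and `O j` loses nothing, as it contains `x ∈ F j`; otherwise
only `O j` loses elements, and there are at most `k` of them by extendibility. -/
theorem Remainder.exists_insert {k : ℕ} (hI : IsExtendible k I) {T : Finset α}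
    {F S O : Fin ℓ → Finset α} (h : Remainder I T F S O) (hFI : ∀ j, F j ∈ I)
    (hF : ∀ j j', j ≠ j' → Disjoint (F j) (F j')) {x : α} {j : Fin ℓ} (hxS : x ∉ S j)
    (hSF : insert x (S j) ⊆ F j) :
    ∃ O' : Fin ℓ → Finset α, (∀ i, O' i ⊆ O i) ∧
      Remainder I T F (Function.update S j (insert x (S j))) O' ∧
      ∑ i, (O i \ O' i).card ≤ max k (ℓ - 1) := by
  have hxF : x ∈ F j := hSF (Finset.mem_insert_self _ _)
  by_cases hxT : x ∈ T
  · have hxO : x ∈ O j := h.keep j (Finset.mem_inter.2 ⟨hxT, hxF⟩)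
    refine ⟨fun i => if i = j then O i else (O i).erase x, fun i => ?_, ⟨fun i => ?_, fun i => ?_,
      fun i => ?_, fun i i' hii => ?_⟩, ?_⟩
    · dsimp only; split_ifs
      · exact subset_rfl
      · exact Finset.erase_subset _ _
    · split_ifs
      · exact h.subset i
      · exact (Finset.erase_subset _ _).trans (h.subset i)
    · split_ifs with hij
      · exact h.keep i
      · refine Finset.subset_erase.2 ⟨h.keep i, fun hx => ?_⟩
        exact Finset.disjoint_left.1 (hF i j hij) (Finset.mem_inter.1 hx).2 hxF
    · split_ifs with hij
      · subst hij
        rw [Function.update_self, Finset.insert_union,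
          Finset.insert_eq_of_mem (Finset.mem_union_right _ hxO)]
        exact h.indep i
      · rw [Function.update_of_ne hij]
        exact hI.down_closed _ _
          (Finset.union_subset_union_right (Finset.erase_subset _ _)) (h.indep i)
    · by_cases hi' : i' = j
      · subst hi'
        rw [if_neg hii, Function.update_self, Finset.disjoint_insert_right]
        exact ⟨Finset.notMem_erase _ _, (h.fresh i i' hii).mono_left (Finset.erase_subset _ _)⟩
      · rw [Function.update_of_ne hi']
        refine (h.fresh i i' hii).mono_left ?_
        split_ifs
        · exact subset_rfl
        · exact Finset.erase_subset _ _
    · have h1 : ∀ i, (O i \ (if i = j then O i else (O i).erase x)).card ≤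
          if i = j then 0 else 1 := by
        intro i
        split_ifs
        · simp
        · refine (Finset.card_le_card (t := {x}) fun y hy => ?_).trans_eq
            (Finset.card_singleton x)
          simp only [Finset.mem_sdiff, Finset.mem_erase, Finset.mem_singleton] at hy ⊢
          tauto
      refine (Finset.sum_le_sum fun i _ => h1 i).trans (le_trans ?_ (le_max_right _ _))
      have h2 : ∑ i : Fin ℓ, (if i = j then 0 else 1) = (Finset.univ.erase j).card := by
        rw [Finset.card_eq_sum_ones, ← Finset.sum_erase_add _ _ (Finset.mem_univ j)]
        simp only [if_true, add_zero]
        exact Finset.sum_congr rfl fun i hi => if_neg (Finset.ne_of_mem_erase hi)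
      rw [h2, Finset.card_erase_of_mem (Finset.mem_univ j), Finset.card_univ, Fintype.card_fin]
  · -- The part `T ∩ F j` is made part of the smaller set of the exchange, which protects it.
    have hA : S j ∪ T ∩ F j ⊆ F j := Finset.union_subset
      ((Finset.subset_insert _ _).trans hSF) Finset.inter_subset_right
    obtain ⟨Y, hY, hYk, hYI⟩ := hI.exchange (S j ∪ T ∩ F j) (S j ∪ O j)
      (Finset.union_subset_union_right (h.keep j)) (hI.down_closed _ _ hA (hFI j)) (h.indep j) x
      (by
        rw [Finset.mem_union]
        rintro (hx | hx)
        · exact hxS hx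
        · exact hxT (h.subset j hx))
      (hI.down_closed _ _ (Finset.insert_subset hxF hA) (hFI j))
    have hYS : ∀ y ∈ Y, y ∉ S j ∪ T ∩ F j := fun y hy => (Finset.mem_sdiff.1 (hY hy)).2
    have hsub : ∀ i, Function.update O j (O j \ Y) i ⊆ O i := by
      intro i
      by_cases hij : i = j
      · subst hij
        rw [Function.update_self]
        exact Finset.sdiff_subset
      · rw [Function.update_of_ne hij]
    refine ⟨Function.update O j (O j \ Y), hsub, ⟨fun i => (hsub i).trans (h.subset i),
      fun i => ?_, fun i => ?_, fun i i' hii => ?_⟩, ?_⟩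
    · by_cases hij : i = j
      · subst hij
        rw [Function.update_self]
        exact fun y hy => Finset.mem_sdiff.2
          ⟨h.keep i hy, fun hyY => hYS y hyY (Finset.mem_union_right _ hy)⟩
      · rw [Function.update_of_ne hij]
        exact h.keep i
    · by_cases hij : i = j
      · subst hij
        rw [Function.update_self, Function.update_self]
        refine hI.down_closed _ _ (fun y hy => ?_) hYI
        simp only [Finset.mem_union, Finset.mem_insert, Finset.mem_sdiff] at hy ⊢
        rcases hy with (hy | hy) | hy
        · exact Or.inl hy
        · exact Or.inr ⟨Or.inl hy, fun hyY => hYS y hyY (Finset.mem_union_left _ hy)⟩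
        · exact Or.inr ⟨Or.inr hy.1, hy.2⟩
      · rw [Function.update_of_ne hij, Function.update_of_ne hij]
        exact h.indep i
    · by_cases hi' : i' = j
      · subst hi'
        rw [Function.update_self, Finset.disjoint_insert_right]
        exact ⟨fun hx => hxT (h.subset i (hsub i hx)), (h.fresh i i' hii).mono_left (hsub i)⟩
      · rw [Function.update_of_ne hi']
        exact (h.fresh i i' hii).mono_left (hsub i)
    · refine le_trans ?_ (hYk.trans (le_max_left _ _))
      rw [← Finset.sum_erase_add _ _ (Finset.mem_univ j), Finset.sum_eq_zero, zero_add,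
        Function.update_self]
      · exact Finset.card_le_card fun y hy => by
          simp only [Finset.mem_sdiff] at hy
          tauto
      · intro i hi
        rw [Function.update_of_ne (Finset.ne_of_mem_erase hi), Finset.sdiff_self,
          Finset.card_empty]

/-- The total excess of the marginals of the discarded elements over the weights `w`. -/
def totalCharge (f : Finset α → ℝ) (w : α → ℝ) (T : Finset α) (S O : Fin ℓ → Finset α) : ℝ :=
  ∑ j, ∑ x ∈ T \ O j, (marginal f x (S j) - w x)

theorem totalCharge_le_add (hf : IsSubmodular f) (w : α → ℝ) {T : Finset α}
    {F S S' O O' : Fin ℓ → Finset α} {θ : ℝ} (hO : ∀ j, O j ⊆ T) (hOO : ∀ j, O' j ⊆ O j)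
    (hSS : ∀ j, S j ⊆ S' j) (hSF : ∀ j, S' j ⊆ F j) (hF : ∀ j, T ∩ F j ⊆ O' j)
    (h : ∀ j, ∀ x ∈ O j \ O' j, marginal f x (S j) ≤ θ + w x) :
    totalCharge f w T S' O' ≤ totalCharge f w T S O + (∑ j, (O j \ O' j).card : ℕ) * θ := by
  unfold totalCharge
  rw [Nat.cast_sum, Finset.sum_mul, ← Finset.sum_add_distrib]
  refine Finset.sum_le_sum fun j _ => ?_
  have h1 : T \ O' j = T \ O j ∪ O j \ O' j := by
    ext x
    have := @hO j x
    have := @hOO j x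
    simp only [Finset.mem_sdiff, Finset.mem_union]
    tauto
  have h2 : Disjoint (T \ O j) (O j \ O' j) :=
    Finset.disjoint_left.2 fun x hx hx' =>
      (Finset.mem_sdiff.1 hx).2 (Finset.mem_sdiff.1 hx').1
  calc ∑ x ∈ T \ O' j, (marginal f x (S' j) - w x)
      ≤ ∑ x ∈ T \ O' j, (marginal f x (S j) - w x) := by
        refine Finset.sum_le_sum fun x hx => sub_le_sub_right (hf.marginal_anti (hSS j) ?_) _
        intro hxS
        rw [Finset.mem_sdiff] at hx
        exact hx.2 (hF j (Finset.mem_inter.2 ⟨hx.1, hSF j hxS⟩))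
    _ = ∑ x ∈ T \ O j, (marginal f x (S j) - w x) +
          ∑ x ∈ O j \ O' j, (marginal f x (S j) - w x) := by
        rw [h1, Finset.sum_union h2]
    _ ≤ _ := by
        refine add_le_add le_rfl ?_
        rw [← nsmul_eq_mul]
        exact Finset.sum_le_card_nsmul _ _ _ fun x hx => by linarith [h j x hx]

end Exchange

/-! ### Passes of the simultaneous greedy procedure -/

section Passes

variable {α : Type u} {ℓ m k : ℕ} {f : Finset α → ℝ} {I : Set (Finset α)}
  {c : Fin m → α → ℝ} {ρ κ τ θ : ℝ}

/-- The density threshold `∑ r, ρ * c_r x` for the marginals of the element `x`. -/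
def densityBound (c : Fin m → α → ℝ) (ρ : ℝ) (x : α) : ℝ := ∑ r, ρ * c r x

theorem densityBound_nonneg (hc : ∀ r x, 0 ≤ c r x) (hρ : 0 ≤ ρ) (x : α) :
    0 ≤ densityBound c ρ x :=
  Finset.sum_nonneg fun r _ => mul_nonneg hρ (hc r x)

theorem sum_densityBound (c : Fin m → α → ℝ) (ρ : ℝ) (S : Finset α) :
    ∑ x ∈ S, densityBound c ρ x = ρ * ∑ r, ∑ x ∈ S, c r x := by
  unfold densityBound
  rw [Finset.sum_comm, Finset.mul_sum]
  exact Finset.sum_congr rfl fun r _ => (Finset.mul_sum _ _ _).symm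

/-- In passing from `st` to `st'`, solutions only grow, elements only become unavailable, and a recorded
rejection is kept. -/
structure SGSState.Extends (st st' : SGSState α ℓ m) : Prop where
  sol : ∀ j, st.sol j ⊆ st'.sol j
  avail : st'.avail ⊆ st.avail
  rejected : st'.rejected = false → st.rejected = false

theorem SGSState.Extends.refl (st : SGSState α ℓ m) : st.Extends st :=
  ⟨fun _ => subset_rfl, subset_rfl, id⟩

theorem SGSState.Extends.trans {st st' st'' : SGSState α ℓ m} (h : st.Extends st')
    (h' : st'.Extends st'') : st.Extends st'' :=
  ⟨fun j => (h.sol j).trans (h'.sol j), h'.avail.trans h.avail,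
    fun hr => h.rejected (h'.rejected hr)⟩

variable [DecidableEq α]

/-- What holds throughout `knapsackSGS`.  A failed check leaves a trace in `reject`: some solution and
some singleton are together worth at least `ρ`.  As long as all checks succeed, `charge` bounds the
marginals of all elements of a set `T ∈ I` that have been discarded, for any final solutions `F` that
extend the current ones. -/
structure SGSInv (f : Finset α → ℝ) (I : Set (Finset α)) (c : Fin m → α → ℝ) (ρ κ : ℝ)
    (st : SGSState α ℓ m) : Prop where
  indep : ∀ j, st.sol j ∈ I
  load_eq : ∀ j r, st.load j r = ∑ x ∈ st.sol j, c r x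
  load_le : ∀ j r, st.load j r ≤ 1
  mem_avail : ∀ x, x ∈ st.avail ↔ ∀ j, x ∉ st.sol j
  disjoint : ∀ j j', j ≠ j' → Disjoint (st.sol j) (st.sol j')
  gain : ∀ j, f ∅ + ∑ x ∈ st.sol j, densityBound c ρ x ≤ f (st.sol j)
  reject : st.rejected = true → ∃ j x, ρ ≤ f (st.sol j) + f {x}
  charge : st.rejected = false → ∀ T ∈ I, ∀ F : Fin ℓ → Finset α, (∀ j, F j ∈ I) →
    (∀ j j', j ≠ j' → Disjoint (F j) (F j')) → (∀ j, st.sol j ⊆ F j) →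
    ∃ O : Fin ℓ → Finset α, Remainder I T F st.sol O ∧
      totalCharge f (densityBound c ρ) T st.sol O ≤ κ * ∑ j, (f (st.sol j) - f ∅)

/-- The pair `(x, j)` does not qualify at marginal threshold `θ`, unless a check has failed. -/
def Tight (f : Finset α → ℝ) (I : Set (Finset α)) (c : Fin m → α → ℝ) (ρ θ : ℝ)
    (st : SGSState α ℓ m) (x : α) (j : Fin ℓ) : Prop :=
  st.rejected = false → x ∈ st.avail → insert x (st.sol j) ∈ I →
    marginal f x (st.sol j) ≤ max θ (densityBound c ρ x)

theorem Tight.extends (hf : IsSubmodular f) (hI : IsIndepSystem I) {st st' : SGSState α ℓ m}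
    (hst' : SGSInv f I c ρ κ st') (he : st.Extends st') {x : α} {j : Fin ℓ}
    (h : Tight f I c ρ θ st x j) : Tight f I c ρ θ st' x j := by
  intro hr hx hi
  exact (hf.marginal_anti (he.sol j) ((hst'.mem_avail x).1 hx j)).trans
    (h (he.rejected hr) (he.avail hx)
      (hI.down_closed _ _ (Finset.insert_subset_insert _ (he.sol j)) hi))

/-- Adding a qualifying element that passes the check.  The marginals of the at most
`max k (ℓ - 1)` newly discarded elements exceed their density thresholds by at most `θ` each. -/
theorem SGSInv.add (hf : IsSubmodular f) (hI : IsExtendible k I) (hc : ∀ r x, 0 ≤ c r x)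
    (hρ : 0 ≤ ρ) (hθ : 0 ≤ θ) (hκ : 0 ≤ κ)
    (hκτ : ((max k (ℓ - 1) : ℕ) : ℝ) * θ ≤ κ * τ)
    {st : SGSState α ℓ m} (hst : SGSInv f I c ρ κ st)
    (ht : ∀ x j, Tight f I c ρ θ st x j) {x : α} {j : Fin ℓ} (hx : x ∈ st.avail)
    (hxI : insert x (st.sol j) ∈ I)
    (hm : max τ (densityBound c ρ x) ≤ marginal f x (st.sol j))
    (hl : ∀ r, st.load j r + c r x ≤ 1) :
    SGSInv f I c ρ κ
      { sol := Function.update st.sol j (insert x (st.sol j))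
        load := Function.update st.load j fun r => st.load j r + c r x
        avail := st.avail.erase x
        rejected := st.rejected } := by
  have hxs := (hst.mem_avail x).1 hx
  have hτm := (le_max_left _ _).trans hm
  have hwm := (le_max_right _ _).trans hm
  have hsub : ∀ i, st.sol i ⊆ Function.update st.sol j (insert x (st.sol j)) i := by
    intro i
    by_cases hij : i = j
    · subst hij
      rw [Function.update_self]
      exact Finset.subset_insert _ _
    · rw [Function.update_of_ne hij]
  have hle : ∀ i, f (st.sol i) ≤ f (Function.update st.sol j (insert x (st.sol j)) i) := by
    intro i
    by_cases hij : i = j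
    · subst hij
      rw [Function.update_self]
      have := (densityBound_nonneg hc hρ x).trans hwm
      unfold marginal at this
      linarith
    · rw [Function.update_of_ne hij]
  refine ⟨fun i => ?_, fun i r => ?_, fun i r => ?_, fun y => ?_, fun i i' hii => ?_, fun i => ?_,
    fun hr => ?_, fun hr T hT F hFI hF hSF => ?_⟩
  · by_cases hij : i = j
    · subst hij; simpa using hxI
    · simpa [hij] using hst.indep i
  · by_cases hij : i = j
    · subst hij
      simp [Finset.sum_insert (hxs i), hst.load_eq, add_comm]
    · simpa [hij] using hst.load_eq i r
  · by_cases hij : i = j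
    · subst hij; simpa using hl r
    · simpa [hij] using hst.load_le i r
  · simp only [Finset.mem_erase, hst.mem_avail]
    constructor
    · rintro ⟨hne, hy⟩ i
      by_cases hij : i = j
      · subst hij; simp [hne, hy]
      · simpa [hij] using hy i
    · intro h
      refine ⟨?_, fun i hi => h i (hsub i hi)⟩
      rintro rfl
      exact h j (by simp)
  · by_cases hij : i = j
    · subst hij
      have hi' : i' ≠ i := fun h => hii h.symm
      simp only [Function.update_self, Function.update_of_ne hi', Finset.disjoint_insert_left]
      exact ⟨hxs i', hst.disjoint i i' hii⟩
    · by_cases hi' : i' = j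
      · subst hi'
        simp only [Function.update_self, Function.update_of_ne hij,
          Finset.disjoint_insert_right]
        exact ⟨hxs i, hst.disjoint i i' hii⟩
      · simpa [hij, hi'] using hst.disjoint i i' hii
  · by_cases hij : i = j
    · subst hij
      simp only [Function.update_self, Finset.sum_insert (hxs i)]
      have := hst.gain i
      unfold marginal at hwm
      linarith
    · simpa [hij] using hst.gain i
  · obtain ⟨i, y, h⟩ := hst.reject hr
    exact ⟨i, y, h.trans (add_le_add_left (hle i) _)⟩
  · obtain ⟨O, hO, hch⟩ := hst.charge hr T hT F hFI hF fun i => (hsub i).trans (hSF i)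
    have hSFj : insert x (st.sol j) ⊆ F j := by simpa using hSF j
    obtain ⟨O', hOO, hO', hcard⟩ := hO.exists_insert hI hFI hF (hxs j) hSFj
    refine ⟨O', hO', ?_⟩
    have h1 := totalCharge_le_add hf (densityBound c ρ) (θ := θ) hO.subset hOO hsub hSF hO'.keep
      (by
        intro i y hy
        rw [Finset.mem_sdiff] at hy
        have hyF : y ∉ F i := fun h =>
          hy.2 (hO'.keep i (Finset.mem_inter.2 ⟨hO.subset i hy.1, h⟩))
        have hya : y ∈ st.avail := by
          refine (hst.mem_avail y).2 fun i' hi' => ?_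
          by_cases hii : i = i'
          · subst hii
            exact hyF (hSF i (hsub i hi'))
          · exact Finset.disjoint_left.1 (hO.fresh i i' hii) hy.1 hi'
        refine (ht y i hr hya (hI.down_closed _ _ ?_ (hO.indep i))).trans ?_
        · exact Finset.insert_subset (Finset.mem_union_right _ hy.1) Finset.subset_union_left
        · have := densityBound_nonneg hc hρ y
          exact max_le (by linarith) (by linarith))
    have h2 : ((∑ i, (O i \ O' i).card : ℕ) : ℝ) * θ ≤ κ * τ :=
      (mul_le_mul_of_nonneg_right (by exact_mod_cast hcard) hθ).trans hκτ
    have h3 : κ * ∑ i, (f (st.sol i) - f ∅) + κ * τ ≤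
        κ * ∑ i, (f (Function.update st.sol j (insert x (st.sol j)) i) - f ∅) := by
      rw [← mul_add]
      refine mul_le_mul_of_nonneg_left ?_ hκ
      rw [← Finset.sum_erase_add _ _ (Finset.mem_univ j),
        ← Finset.sum_erase_add _ _ (Finset.mem_univ j), Function.update_self]
      have : ∑ i ∈ Finset.univ.erase j, (f (st.sol i) - f ∅) ≤
          ∑ i ∈ Finset.univ.erase j,
            (f (Function.update st.sol j (insert x (st.sol j)) i) - f ∅) :=
        Finset.sum_le_sum fun i _ => sub_le_sub_right (hle i) _
      unfold marginal at hτm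
      linarith
    exact h1.trans ((add_le_add hch h2).trans h3)

/-- If the check fails, then the elements of `S j + x` overfill a knapsack, and each of them has
contributed at least its density threshold. -/
theorem SGSInv.fail (hf : IsSubmodular f) (h0 : ∀ S, 0 ≤ f S) (hc : ∀ r x, 0 ≤ c r x)
    (hρ : 0 ≤ ρ) {st : SGSState α ℓ m} (hst : SGSInv f I c ρ κ st) {x : α} {j : Fin ℓ}
    (hx : x ∈ st.avail) (hm : densityBound c ρ x ≤ marginal f x (st.sol j))
    (hl : ¬ ∀ r, st.load j r + c r x ≤ 1) :
    SGSInv f I c ρ κ { st with rejected := true } := by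
  refine ⟨hst.indep, hst.load_eq, hst.load_le, hst.mem_avail, hst.disjoint, hst.gain,
    fun _ => ⟨j, x, ?_⟩, fun hr => by simp at hr⟩
  have hxs := (hst.mem_avail x).1 hx j
  push Not at hl
  obtain ⟨r, hr⟩ := hl
  have h1 : ρ ≤ ∑ y ∈ insert x (st.sol j), densityBound c ρ y := by
    rw [sum_densityBound]
    refine le_mul_of_one_le_right hρ ?_
    refine le_trans ?_ (Finset.single_le_sum
      (fun r' _ => Finset.sum_nonneg fun y _ => hc r' y) (Finset.mem_univ r))
    rw [Finset.sum_insert hxs, ← hst.load_eq]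
    linarith
  rw [Finset.sum_insert hxs] at h1
  have h2 := hst.gain j
  have h3 := hf.marginal_anti (Finset.empty_subset (st.sol j)) hxs
  have h4 : marginal f x ∅ = f {x} - f ∅ := by simp [marginal]
  have h5 := h0 ∅
  show ρ ≤ f (st.sol j) + f {x}
  linarith

theorem tryPair_ensures (hf : IsSubmodular f) (h0 : ∀ S, 0 ≤ f S) (hI : IsExtendible k I)
    (hc : ∀ r x, 0 ≤ c r x) (hρ : 0 ≤ ρ) (hθ : 0 ≤ θ) (hκ : 0 ≤ κ)
    (hκτ : ((max k (ℓ - 1) : ℕ) : ℝ) * θ ≤ κ * τ)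
    {st : SGSState α ℓ m} (hst : SGSInv f I c ρ κ st)
    (ht : ∀ x j, Tight f I c ρ θ st x j) (x : α) (j : Fin ℓ) :
    Prog.Ensures f I (tryPair c ρ τ st x j)
      (fun st' => SGSInv f I c ρ κ st' ∧ st.Extends st' ∧ Tight f I c ρ τ st' x j)
      (3, 4 * m, 3) := by
  classical
  unfold tryPair
  by_cases hx : x ∈ st.avail
  swap
  · rw [if_neg hx]
    exact Prog.Ensures.ret ⟨hst, .refl _, fun _ h => absurd h hx⟩
  rw [if_pos hx]
  refine Prog.Ensures.mono (Prog.Ensures.indep (b := (2, 4 * m, 3)) ?_) (fun _ h => h)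
    (by simp)
  by_cases hxI : insert x (st.sol j) ∈ I
  swap
  · rw [decide_eq_false hxI]
    exact Prog.Ensures.ret ⟨hst, .refl _, fun _ _ h => absurd h hxI⟩
  rw [decide_eq_true hxI, if_pos rfl]
  refine Prog.Ensures.mono (Prog.Ensures.value (Prog.Ensures.value (Prog.Ensures.knapOps
    (Prog.Ensures.otherOps (b := (0, 2 * m, 0)) ?_)))) (fun _ h => h)
    (by simp only [Prod.le_def, Prod.fst_add, Prod.snd_add]; omega)
  by_cases hm : max τ (∑ r, ρ * c r x) ≤ f (insert x (st.sol j)) - f (st.sol j)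
  swap
  · rw [if_neg hm]
    exact Prog.Ensures.ret ⟨hst, .refl _, fun _ _ _ => (not_le.1 hm).le⟩
  rw [if_pos hm]
  refine Prog.Ensures.mono (Prog.Ensures.knapOps (b := 0) ?_) (fun _ h => h)
    (by simp)
  by_cases hl : ∀ r, st.load j r + c r x ≤ 1
  · rw [if_pos hl]
    refine Prog.Ensures.ret ⟨hst.add hf hI hc hρ hθ hκ hκτ ht hx hxI hm hl, ⟨fun i => ?_,
      Finset.erase_subset _ _, id⟩, fun _ h => absurd h (Finset.notMem_erase _ _)⟩
    by_cases hij : i = j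
    · subst hij; simp
    · simp [hij]
  · rw [if_neg hl]
    exact Prog.Ensures.ret ⟨hst.fail hf h0 hc hρ hx ((le_max_right _ _).trans hm) hl,
      ⟨fun _ => subset_rfl, subset_rfl, fun h => by simp at h⟩, fun h => by simp at h⟩

theorem scanPairs_ensures (hf : IsSubmodular f) (h0 : ∀ S, 0 ≤ f S) (hI : IsExtendible k I)
    (hc : ∀ r x, 0 ≤ c r x) (hρ : 0 ≤ ρ) (hθ : 0 ≤ θ) (hκ : 0 ≤ κ)
    (hκτ : ((max k (ℓ - 1) : ℕ) : ℝ) * θ ≤ κ * τ) (L : List (α × Fin ℓ))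
    {st : SGSState α ℓ m} (hst : SGSInv f I c ρ κ st)
    (ht : ∀ x j, Tight f I c ρ θ st x j) :
    Prog.Ensures f I (scanPairs c ρ τ L st)
      (fun st' => SGSInv f I c ρ κ st' ∧ st.Extends st' ∧
        ∀ p ∈ L, Tight f I c ρ τ st' p.1 p.2)
      (L.length • (3, 4 * m, 3)) := by
  induction L generalizing st with
  | nil => exact Prog.Ensures.ret ⟨hst, .refl _, by simp⟩
  | cons p L ih =>
    refine Prog.Ensures.mono (Prog.Ensures.bind
      (R' := fun st' => SGSInv f I c ρ κ st' ∧ st.Extends st' ∧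
        ∀ q ∈ p :: L, Tight f I c ρ τ st' q.1 q.2)
      (tryPair_ensures hf h0 hI hc hρ hθ hκ hκτ hst ht p.1 p.2)
      (b' := L.length • (3, 4 * m, 3)) fun st₁ h₁ => ?_)
      (fun _ h => h) (le_of_eq (by rw [List.length_cons, succ_nsmul, add_comm]))
    refine (ih h₁.1 fun x j => (ht x j).extends hf hI.toIsIndepSystem h₁.1 h₁.2.1).mono
      (fun st₂ h₂ => ⟨h₂.1, h₁.2.1.trans h₂.2.1, fun q hq => ?_⟩) le_rfl
    rcases List.mem_cons.1 hq with rfl | hq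
    · exact h₁.2.2.extends hf hI.toIsIndepSystem h₂.1 h₂.2.1
    · exact h₂.2.2 q hq

end Passes

/-! ### The guarantee of the simultaneous greedy procedure -/

section Greedy

variable {α : Type u} [DecidableEq α] [Fintype α] {ℓ m k P : ℕ} {f : Finset α → ℝ}
  {I : Set (Finset α)} {c : Fin m → α → ℝ} {ρ θ a ε Δ V : ℝ}

/-- If no check has failed, then every element of `T` is in a solution, has been discarded from the
remainder of `T`, or has a small marginal in the end. -/
theorem SGSInv.le_of_not_rejected (hf : IsSubmodular f) (h0 : ∀ S, 0 ≤ f S)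
    (hI : IsIndepSystem I) (hc : ∀ r x, 0 ≤ c r x) (hρ : 0 ≤ ρ) (hε0 : 0 ≤ ε) (hε1 : ε < 1)
    (hℓ : 0 < ℓ) (hcov : ∀ (T : Finset α) (S : Fin ℓ → Finset α),
      (∀ j j', j ≠ j' → Disjoint (S j) (S j')) → ℓ * (a * f T) ≤ ∑ j, f (T ∪ S j))
    {st : SGSState α ℓ m} (hst : SGSInv f I c ρ ((max k (ℓ - 1) : ℕ) / (1 - ε)) st)
    (hr : st.rejected = false) (hθ0 : 0 ≤ θ) (ht : ∀ x j, Tight f I c ρ θ st x j)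
    (hθ : Fintype.card α * θ ≤ ε * Δ / (1 - ε)) (hΔV : Δ ≤ V)
    (hV : ∀ j, f (st.sol j) ≤ V) {T : Finset α} (hT : IsFeasible I c T) :
    a * f T ≤ ((max k (ℓ - 1) : ℕ) + 1) / (1 - ε) * V + ρ * m := by
  have hε : 0 < 1 - ε := sub_pos.2 hε1
  have hℓ' : (0 : ℝ) < ℓ := Nat.cast_pos.2 hℓ
  obtain ⟨O, hO, hch⟩ := hst.charge hr T hT.1 st.sol hst.indep hst.disjoint fun _ => subset_rfl
  have hw : ∑ x ∈ T, densityBound c ρ x ≤ ρ * m := by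
    rw [sum_densityBound]
    refine mul_le_mul_of_nonneg_left ?_ hρ
    simpa using Finset.sum_le_sum fun r (_ : r ∈ Finset.univ) => hT.2 r
  have hj : ∀ j, f (T ∪ st.sol j) ≤ f (st.sol j) +
      (∑ x ∈ T \ O j, (marginal f x (st.sol j) - densityBound c ρ x) +
        (ε * Δ / (1 - ε) + ρ * m)) := by
    intro j
    generalize ε * Δ / (1 - ε) = e at hθ ⊢
    have hsplit : T \ st.sol j = T \ O j ∪ O j \ st.sol j := by
      ext x
      have h1 := @hO.subset j x
      have h2 := @hO.keep j x
      simp only [Finset.mem_inter] at h2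
      simp only [Finset.mem_sdiff, Finset.mem_union]
      tauto
    have hdis : Disjoint (T \ O j) (O j \ st.sol j) :=
      Finset.disjoint_left.2 fun x hx hx' =>
        (Finset.mem_sdiff.1 hx).2 (Finset.mem_sdiff.1 hx').1
    have h1 := hf.union_le_add_sum_marginal (st.sol j) T
    have h2 : ∑ x ∈ O j \ st.sol j, (marginal f x (st.sol j) - densityBound c ρ x) ≤ e := by
      refine le_trans ?_ hθ
      refine (Finset.sum_le_card_nsmul _ _ θ fun x hx => ?_).trans ?_
      · rw [Finset.mem_sdiff] at hx
        have hxa : x ∈ st.avail := by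
          refine (hst.mem_avail x).2 fun i hi => ?_
          by_cases hij : j = i
          · subst hij
            exact hx.2 hi
          · exact Finset.disjoint_left.1 (hO.fresh j i hij) hx.1 hi
        have h3 := ht x j hr hxa (hI.down_closed _ _ (Finset.insert_subset
          (Finset.mem_union_right _ hx.1) Finset.subset_union_left) (hO.indep j))
        have h4 := densityBound_nonneg hc hρ x
        have h5 : max θ (densityBound c ρ x) ≤ θ + densityBound c ρ x :=
          max_le (le_add_of_nonneg_right h4) (le_add_of_nonneg_left hθ0)
        linarith only [h3, h5]
      · rw [nsmul_eq_mul]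
        exact mul_le_mul_of_nonneg_right (by exact_mod_cast Finset.card_le_univ _) hθ0
    have h3 : ∑ x ∈ T \ st.sol j, densityBound c ρ x ≤ ρ * m :=
      (Finset.sum_le_sum_of_subset_of_nonneg Finset.sdiff_subset
        fun x _ _ => densityBound_nonneg hc hρ x).trans hw
    have h4 : ∑ x ∈ T \ st.sol j, marginal f x (st.sol j) =
        ∑ x ∈ T \ O j, (marginal f x (st.sol j) - densityBound c ρ x) +
        ∑ x ∈ O j \ st.sol j, (marginal f x (st.sol j) - densityBound c ρ x) +
        ∑ x ∈ T \ st.sol j, densityBound c ρ x := by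
      rw [← Finset.sum_union hdis, ← hsplit, ← Finset.sum_add_distrib]
      exact Finset.sum_congr rfl fun x _ => by ring
    linarith only [h1, h2, h3, h4]
  have hκ : (0 : ℝ) ≤ (max k (ℓ - 1) : ℕ) / (1 - ε) := div_nonneg (Nat.cast_nonneg _) hε.le
  have hsum : ∑ j, f (st.sol j) ≤ ℓ * V := by
    simpa using Finset.sum_le_sum fun j (_ : j ∈ Finset.univ) => hV j
  have hsum' : ∑ j, (f (st.sol j) - f ∅) ≤ ℓ * V :=
    (Finset.sum_le_sum fun j _ => sub_le_self _ (h0 ∅)).trans hsum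
  have h1 := (hcov T st.sol hst.disjoint).trans (Finset.sum_le_sum fun j _ => hj j)
  rw [Finset.sum_add_distrib, Finset.sum_add_distrib] at h1
  have h2 : ∑ _j : Fin ℓ, (ε * Δ / (1 - ε) + ρ * m) = ℓ * (ε * Δ / (1 - ε) + ρ * m) := by
    rw [Finset.sum_const, Finset.card_univ, Fintype.card_fin, nsmul_eq_mul]
  have h3 : ε * Δ / (1 - ε) ≤ ε * V / (1 - ε) :=
    div_le_div_of_nonneg_right (mul_le_mul_of_nonneg_left hΔV hε0) hε.le
  have h4 := hch.trans (mul_le_mul_of_nonneg_left hsum' hκ)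
  unfold totalCharge at h4
  rw [h2] at h1
  refine le_of_mul_le_mul_left ?_ hℓ'
  have h5 : (ℓ : ℝ) * (((max k (ℓ - 1) : ℕ) + 1) / (1 - ε) * V + ρ * m) =
      ℓ * V + ((max k (ℓ - 1) : ℕ) / (1 - ε) * (ℓ * V) + ℓ * (ε * V / (1 - ε) + ρ * m)) := by
    field_simp
    ring
  rw [h5]
  exact h1.trans (add_le_add hsum (add_le_add h4
    (mul_le_mul_of_nonneg_left (add_le_add_left h3 _) hℓ'.le)))

/-- What a call of `knapsackSGS` with density threshold `ρ` returns. -/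
structure SGSOutput (f : Finset α → ℝ) (I : Set (Finset α)) (c : Fin m → α → ℝ) (p a ε ρ : ℝ)
    (out : Finset α × Bool) : Prop where
  feasible : IsFeasible I c out.1
  singleton_le : ∀ x, f {x} ≤ f out.1
  empty_le : f ∅ ≤ f out.1
  of_reject : out.2 = true → ρ ≤ 2 * f out.1
  of_not_reject : out.2 = false → ∀ T, IsFeasible I c T →
    a * f T ≤ (p + 1) / (1 - ε) * f out.1 + ρ * m

theorem SGSInv.init (hI : IsIndepSystem I) {κ : ℝ} (hΔ : ∀ x, f {x} - f ∅ ≤ Δ) :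
    SGSInv f I c ρ κ ⟨fun _ : Fin ℓ => ∅, fun _ _ => 0, Finset.univ, false⟩ ∧
      ∀ x j, Tight f I c ρ Δ (⟨fun _ : Fin ℓ => ∅, fun _ (_ : Fin m) => 0,
        Finset.univ, false⟩ : SGSState α ℓ m) x j := by
  obtain ⟨A, hA⟩ := hI.nonempty
  have he : ∅ ∈ I := hI.down_closed _ _ (Finset.empty_subset A) hA
  refine ⟨⟨fun _ => he, by simp, by simp, by simp, by simp, by simp, by simp, ?_⟩, ?_⟩
  · intro _ T hT F _ _ _
    exact ⟨fun _ => T, ⟨fun _ => subset_rfl, fun _ => Finset.inter_subset_left,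
      fun _ => by simpa using hT, by simp⟩, by simp [totalCharge]⟩
  · intro x j _ _ _
    exact le_max_of_le_left (by simpa [marginal] using hΔ x)

/-- The budget of `P` rounds of a loop over `N` pairs with `m` knapsacks, including the computation of
the maximum over `n` singletons, and of the best of `ℓ + n` sets. -/
def sgsBudget (n m ℓ P N : ℕ) : ℕ × ℕ × ℕ :=
  (2 * n + ℓ + 3 * (P * N), 4 * m * (P * N), 2 * n + ℓ + P * (3 * N + 5) + 3)

theorem knapsackSGS_ensures [Nonempty α] (hf : IsSubmodular f) (h0 : ∀ S, 0 ≤ f S)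
    (hI : IsExtendible k I) (hc : ∀ r x, 0 ≤ c r x) (hsing : ∀ x : α, IsFeasible I c {x})
    (hρ : 0 ≤ ρ) (hε0 : 0 < ε) (hε1 : ε < 1) (hℓ : 0 < ℓ)
    (hcov : ∀ (T : Finset α) (S : Fin ℓ → Finset α),
      (∀ j j', j ≠ j' → Disjoint (S j) (S j')) → ℓ * (a * f T) ≤ ∑ j, f (T ∪ S j))
    (hΔ : IsGreatest (Set.range fun x : α => f {x}) Δ)
    (hP : (1 - ε) ^ P ≤ ε / Fintype.card α)
    {pairs : List (α × Fin ℓ)} (hpairs : ∀ p, p ∈ pairs) {fuel : ℕ} (hfuel : P < fuel) :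
    Prog.Ensures f I (knapsackSGS c pairs ρ ε fuel)
      (SGSOutput f I c (max k (ℓ - 1) : ℕ) a ε ρ)
      (sgsBudget (Fintype.card α) m ℓ P pairs.length) := by
  have hε : 0 < 1 - ε := sub_pos.2 hε1
  have hn : (0 : ℝ) < Fintype.card α := Nat.cast_pos.2 Fintype.card_pos
  have hΔx : ∀ x, f {x} ≤ Δ := fun x => hΔ.2 ⟨x, rfl⟩
  have hΔ0 : 0 ≤ Δ := (h0 _).trans (hΔx (Classical.arbitrary α))
  set κ : ℝ := (max k (ℓ - 1) : ℕ) / (1 - ε) with hκdef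
  have hκ : 0 ≤ κ := div_nonneg (Nat.cast_nonneg _) hε.le
  unfold knapsackSGS
  refine Prog.Ensures.mono (Prog.Ensures.bind (b' := P • ((0, 0, 3) +
      (pairs.length • (3, 4 * m, 3) + (0, 0, 2))) + (0, 0, 3) +
      (ℓ + Fintype.card α, 0, ℓ + Fintype.card α))
    (Prog.maxSingleton_ensures (by simp) hΔ) fun Δ' hΔ' => ?_) (fun _ h => h) ?_
  · subst hΔ'
    refine Prog.Ensures.bind (R := fun s : ℝ × SGSState α ℓ m =>
        0 ≤ s.1 ∧ s.1 ≤ ε / Fintype.card α * Δ' ∧ SGSInv f I c ρ κ s.2 ∧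
          ∀ x j, Tight f I c ρ (s.1 / (1 - ε)) s.2 x j)
      (Prog.Ensures.whileLoop
        (test := fun s => decide (ε / (Fintype.card α : ℝ) * Δ' < s.1))
        (Inv := fun i s => (∃ t, t + i = P ∧ s.1 = Δ' * (1 - ε) ^ t) ∧ SGSInv f I c ρ κ s.2 ∧
          ∀ x j, Tight f I c ρ (s.1 / (1 - ε)) s.2 x j)
        (i := P) ?_ ?_ ?_ ?_ hfuel) ?_
    · exact fun s => Prog.Ensures.mono (Prog.Ensures.otherOps (b := 0) (Prog.Ensures.ret
        (R := fun t => t = decide (ε / (Fintype.card α : ℝ) * Δ' < s.1)) rfl))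
        (fun _ h => h) (by simp)
    · rintro i s ⟨⟨t, hti, hs⟩, hinv, htight⟩ htest
      have htest' := of_decide_eq_true htest
      -- After `P` rounds the threshold is too small for another round.
      obtain ⟨i', rfl⟩ : ∃ i', i = i' + 1 := by
        cases i with
        | succ i' => exact ⟨i', rfl⟩
        | zero =>
          exfalso
          obtain rfl : t = P := hti
          rw [hs, mul_comm] at htest'
          exact absurd (mul_le_mul_of_nonneg_left hP hΔ0) (not_le.2 htest')
      have hs0 : 0 ≤ s.1 := by rw [hs]; positivity
      refine ⟨i', rfl, ?_⟩
      refine Prog.Ensures.bind (scanPairs_ensures hf h0 hI hc hρ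
        (div_nonneg hs0 hε.le) hκ (le_of_eq (by rw [hκdef]; ring)) pairs hinv htight)
        fun st hst => Prog.Ensures.mono (Prog.Ensures.otherOps (b := 0) (Prog.Ensures.ret ?_))
          (fun _ h => h) (by simp)
      refine ⟨⟨t + 1, by omega, by rw [hs]; ring⟩, hst.1, fun x j => ?_⟩
      rw [mul_div_assoc, mul_div_cancel₀ _ hε.ne']
      exact hst.2.2 (x, j) (hpairs _)
    · rintro i s ⟨⟨t, hti, hs⟩, hinv, htight⟩ htest
      exact ⟨by rw [hs]; positivity, not_lt.1 (of_decide_eq_false htest), hinv, htight⟩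
    · obtain ⟨h1, h2⟩ := SGSInv.init (ℓ := ℓ) (c := c) (ρ := ρ) (κ := κ) (Δ := Δ' / (1 - ε))
        hI.toIsIndepSystem fun x => (sub_le_self _ (h0 ∅)).trans
          ((hΔx x).trans (le_div_self hΔ0 hε (sub_le_self 1 hε0.le)))
      exact ⟨⟨0, by simp, by simp⟩, h1, h2⟩
    · rintro ⟨τ, st⟩ ⟨hτ0, hτ, hinv, htight⟩
      dsimp only at hτ0 hτ hinv htight ⊢
      refine Prog.Ensures.mono (Prog.Ensures.bind (b' := 0) (Prog.argmax_ensures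
        (L := List.ofFn st.sol ++ Finset.univ.toList.map fun x : α => {x}) (by simp; omega))
        fun S hS => Prog.Ensures.ret ?_) (fun _ h => h) (by simp)
      obtain ⟨hSmem, hSmax⟩ := hS
      have hsol : ∀ j, f (st.sol j) ≤ f S := fun j =>
        hSmax _ (List.mem_append_left _ (List.mem_ofFn.2 ⟨j, rfl⟩))
      have hone : ∀ x, f {x} ≤ f S := fun x =>
        hSmax _ (List.mem_append_right _ (List.mem_map.2 ⟨x, by simp, rfl⟩))
      refine ⟨?_, hone, ?_, fun hr => ?_, fun hr T hT => ?_⟩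
      · rcases List.mem_append.1 hSmem with h | h
        · obtain ⟨j, rfl⟩ := List.mem_ofFn.1 h
          exact ⟨hinv.indep j, fun r => (hinv.load_eq j r).symm.trans_le (hinv.load_le j r)⟩
        · obtain ⟨x, -, rfl⟩ := List.mem_map.1 h
          exact hsing x
      · refine le_trans ?_ ((hinv.gain ⟨0, hℓ⟩).trans (hsol _))
        exact le_add_of_nonneg_right
          (Finset.sum_nonneg fun x _ => densityBound_nonneg hc hρ x)
      · obtain ⟨j, x, h⟩ := hinv.reject hr
        show ρ ≤ 2 * f S
        linarith only [hsol j, hone x, h]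
      · refine hinv.le_of_not_rejected hf h0 hI.toIsIndepSystem hc hρ hε0.le hε1 hℓ hcov hr
          (div_nonneg hτ0 hε.le) htight ?_ ?_ hsol hT (Δ := Δ')
        · rw [← mul_div_assoc]
          refine div_le_div_of_nonneg_right ?_ hε.le
          refine (mul_le_mul_of_nonneg_left hτ hn.le).trans_eq ?_
          field_simp
        · obtain ⟨x, hx⟩ := hΔ.1
          exact hx ▸ hone x
  · simp only [sgsBudget, Prod.le_def, Finset.length_toList,
      Finset.card_univ, Prod.smul_mk, smul_eq_mul, Prod.mk_add_mk]
    refine ⟨?_, ?_, ?_⟩ <;> ring_nf <;> omega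

theorem knapsackSGS_runLE {pairs : List (α × Fin ℓ)} {fuel fuel' : ℕ} (h : fuel ≤ fuel') :
    Prog.RunLE f I (knapsackSGS c pairs ρ ε fuel) (knapsackSGS c pairs ρ ε fuel') :=
  Prog.RunLE.bind (.refl _) fun _ =>
    Prog.RunLE.bind (Prog.RunLE.whileLoop (fun _ => .refl _) h _) fun _ => .refl _

end Greedy

/-! ### The guarantee of the density search -/

theorem le_one_add_pow_ceil_logb_div {n ε : ℝ} (hn : 1 ≤ n) (hε0 : 0 < ε) (hε1 : ε ≤ 1) :
    n ≤ (1 + ε) ^ ⌈Real.logb 2 n / ε⌉₊ := by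
  have h1 : (2 : ℝ) ≤ (1 + ε) ^ (1 / ε) := by
    have := one_add_mul_self_le_rpow_one_add (s := ε) (by linarith)
      (p := 1 / ε) (by rw [le_div_iff₀ hε0]; linarith)
    rw [one_div_mul_cancel hε0.ne'] at this
    linarith
  have h2 : 0 ≤ Real.logb 2 n := Real.logb_nonneg (by norm_num) hn
  calc n = 2 ^ Real.logb 2 n :=
        (Real.rpow_logb (by norm_num) (by norm_num) (by linarith)).symm
    _ ≤ ((1 + ε) ^ (1 / ε)) ^ Real.logb 2 n := Real.rpow_le_rpow (by norm_num) h1 h2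
    _ = (1 + ε) ^ (Real.logb 2 n / ε) := by
        rw [← Real.rpow_mul (by linarith), one_div_mul_eq_div]
    _ ≤ (1 + ε) ^ ((⌈Real.logb 2 n / ε⌉₊ : ℕ) : ℝ) :=
        Real.rpow_le_rpow_of_exponent_le (by linarith) (Nat.le_ceil _)
    _ = _ := Real.rpow_natCast _ _

/-- At a density threshold that is at most `1 + ε` times the ideal one, an unrejected run is good. -/
theorem le_of_not_reject {a a₀ ε p m t V x : ℝ} (hε1 : ε < 1) (ha0 : 0 ≤ a₀)
    (ha : a₀ ≤ a) (hp : 0 ≤ p) (hm : 0 ≤ m) (hx : 0 ≤ x)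
    (ht : t ≤ (1 + ε) * x)
    (h : a * x ≤ (p + 1) / (1 - ε) * V + 2 * (1 - ε) * (a₀ / (p + 1 + 2 * m)) * t * m) :
    (1 - ε) * a₀ * x ≤ (p + 1 + 2 * m) * V := by
  have hε : 0 < 1 - ε := sub_pos.2 hε1
  have hQ : 0 < p + 1 + 2 * m := by linarith
  obtain ⟨b, hb⟩ : ∃ b, b = a₀ / (p + 1 + 2 * m) := ⟨_, rfl⟩
  have hba : a₀ = b * (p + 1 + 2 * m) := by rw [hb, div_mul_cancel₀ _ hQ.ne']
  have hb0 : 0 ≤ b := hb ▸ div_nonneg ha0 hQ.le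
  rw [← hb] at h
  have h1 : 2 * (1 - ε) * b * t * m ≤ 2 * (1 - ε) * b * ((1 + ε) * x) * m := by
    gcongr
  have h2 : 2 * (1 - ε) * b * ((1 + ε) * x) * m ≤ 2 * b * x * m := by
    have : 0 ≤ ε ^ 2 * (b * x * m) := by positivity
    linarith
  have h3 : a₀ * x ≤ a * x := mul_le_mul_of_nonneg_right ha hx
  have h4 : b * (p + 1) * x ≤ (p + 1) / (1 - ε) * V := by
    have h4 := h3.trans (h.trans (add_le_add_right (h1.trans h2) _))
    rw [hba] at h4
    refine le_of_add_le_add_right (a := 2 * b * x * m) (le_trans (le_of_eq ?_) h4)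
    ring
  have h5 : (1 - ε) * b * x ≤ V := by
    refine le_of_mul_le_mul_left ?_ (by linarith : 0 < p + 1)
    rw [div_mul_eq_mul_div, le_div_iff₀ hε] at h4
    linarith
  have h6 := mul_le_mul_of_nonneg_left h5 hQ.le
  rw [hba]
  linarith

/-- At a density threshold that is at least the ideal one divided by `1 + ε`, a rejecting run is
good. -/
theorem le_of_reject {a₀ ε p m t V x : ℝ} (hε1 : ε < 1) (ha0 : 0 ≤ a₀) (hε0 : 0 ≤ ε)
    (hp : 0 ≤ p) (hm : 0 ≤ m) (ht : x ≤ (1 + ε) * t)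
    (h : 2 * (1 - ε) * (a₀ / (p + 1 + 2 * m)) * t ≤ 2 * V) :
    (1 - ε) * a₀ * x ≤ (1 + ε) * ((p + 1 + 2 * m) * V) := by
  have hε : 0 < 1 - ε := sub_pos.2 hε1
  have hQ : 0 < p + 1 + 2 * m := by linarith
  obtain ⟨b, hb⟩ : ∃ b, b = a₀ / (p + 1 + 2 * m) := ⟨_, rfl⟩
  have hba : a₀ = b * (p + 1 + 2 * m) := by rw [hb, div_mul_cancel₀ _ hQ.ne']
  have hb0 : 0 ≤ b := hb ▸ div_nonneg ha0 hQ.le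
  rw [← hb] at h
  calc (1 - ε) * a₀ * x ≤ (1 - ε) * a₀ * ((1 + ε) * t) := by gcongr
    _ = (1 + ε) * ((p + 1 + 2 * m) * ((1 - ε) * b * t)) := by rw [hba]; ring
    _ ≤ _ := by gcongr; linarith

section Search

variable {α : Type u} {ℓ m k P : ℕ} {f : Finset α → ℝ}
  {I : Set (Finset α)} {c : Fin m → α → ℝ} {a a₀ p β ε Δ : ℝ}

/-- The invariant of the binary search, with at most `i` more rounds out of `N` to come: the lower end
is `1` or its run has rejected, the upper end is `K` or its run has not. -/
structure SearchInv (f : Finset α → ℝ) (I : Set (Finset α)) (c : Fin m → α → ℝ)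
    (p a ε β Δ : ℝ) (K N i : ℕ) (s : SearchState α) : Prop where
  lo_le : s.lo ≤ s.hi + 1
  hi_le : s.hi ≤ K
  clog_le : Nat.clog 2 (s.hi - s.lo) ≤ i
  length : s.found.length + i = N
  feasible : ∀ S ∈ s.found, IsFeasible I c S
  lo_spec : s.lo = 1 ∨ ∃ S ∈ s.found, β * Δ * (1 + ε) ^ s.lo ≤ 2 * f S
  hi_spec : s.hi = K ∨ ∃ S ∈ s.found, ∀ T, IsFeasible I c T →
    a * f T ≤ (p + 1) / (1 - ε) * f S + β * Δ * (1 + ε) ^ s.hi * m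

theorem SearchInv.step {K N i : ℕ} {s : SearchState α}
    (hs : SearchInv f I c p a ε β Δ K N i s) (hgap : s.lo + 1 < s.hi) {out : Finset α × Bool}
    (hout : SGSOutput f I c p a ε (β * Δ * (1 + ε) ^ ((s.lo + s.hi + 1) / 2)) out) :
    ∃ i', i = i' + 1 ∧ SearchInv f I c p a ε β Δ K N i'
      (if out.2 then ⟨(s.lo + s.hi + 1) / 2, s.hi, out.1 :: s.found⟩
        else ⟨s.lo, (s.lo + s.hi + 1) / 2, out.1 :: s.found⟩) := by
  have h1 := hs.clog_le
  rw [Nat.clog_of_two_le (by norm_num) (by omega)] at h1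
  have h2 := hs.hi_le
  have h3 := hs.length
  have hfeas : ∀ S ∈ out.1 :: s.found, IsFeasible I c S := by
    simpa using ⟨hout.feasible, hs.feasible⟩
  have hclog : ∀ d, d ≤ (s.hi - s.lo + 2 - 1) / 2 → Nat.clog 2 d ≤ i - 1 := fun d hd =>
    (Nat.clog_mono_right 2 hd).trans (by omega)
  refine ⟨i - 1, by omega, ?_⟩
  cases h : out.2 with
  | true =>
    refine ⟨?_, h2, hclog _ ?_, ?_, hfeas, Or.inr ⟨out.1, by simp, hout.of_reject h⟩, ?_⟩
    · simp only [if_true]; omega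
    · simp only [if_true]; omega
    · simp only [if_true, List.length_cons]; omega
    · exact hs.hi_spec.imp id fun ⟨S, hS, hT⟩ => ⟨S, List.mem_cons_of_mem _ hS, hT⟩
  | false =>
    refine ⟨?_, ?_, hclog _ ?_, ?_, hfeas, ?_, Or.inr ⟨out.1, by simp, hout.of_not_reject h⟩⟩
    · simp only [Bool.false_eq_true, if_false]; omega
    · simp only [Bool.false_eq_true, if_false]; omega
    · simp only [Bool.false_eq_true, if_false]; omega
    · simp only [Bool.false_eq_true, if_false, List.length_cons]; omega
    · exact hs.lo_spec.imp id fun ⟨S, hS, hT⟩ => ⟨S, List.mem_cons_of_mem _ hS, hT⟩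

variable [DecidableEq α] [Fintype α]

/-- If `Δ ≥ f ∅` then `T` is worth at most `n` singletons; otherwise, all marginals over the empty set
are non-positive. -/
theorem IsSubmodular.le_empty_or_le_card_mul [Nonempty α] (hf : IsSubmodular f)
    (h0 : ∀ S, 0 ≤ f S) (hΔ : ∀ x, f {x} ≤ Δ) (T : Finset α) :
    f T ≤ f ∅ ∨ f T ≤ Fintype.card α * Δ := by
  have h1 : f T ≤ f ∅ + T.card * (Δ - f ∅) := by
    refine (hf.le_empty_add_sum T).trans (add_le_add_right ?_ _)
    rw [← nsmul_eq_mul]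
    exact Finset.sum_le_card_nsmul _ _ _ fun x _ => sub_le_sub_right (hΔ x) _
  rcases le_total Δ (f ∅) with h | h
  · exact Or.inl (h1.trans (by nlinarith [(Nat.cast_nonneg T.card : (0 : ℝ) ≤ T.card)]))
  · right
    have h2 : (T.card : ℝ) ≤ Fintype.card α := by exact_mod_cast Finset.card_le_univ T
    have h3 : (1 : ℝ) ≤ Fintype.card α := by exact_mod_cast Fintype.card_pos (α := α)
    have h4 := mul_le_mul_of_nonneg_right h2 (sub_nonneg.2 h)
    have h5 := mul_le_mul_of_nonneg_right h3 (h0 ∅)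
    linarith

/-- When the search ends with adjacent exponents, one of its runs has used a density threshold close
enough to the ideal one. -/
theorem SearchInv.le_of_exit [Nonempty α] (hf : IsSubmodular f) (h0 : ∀ S, 0 ≤ f S)
    (hε0 : 0 < ε) (hε1 : ε < 1) (ha0 : 0 ≤ a₀) (ha1 : a₀ ≤ 1) (ha : a₀ ≤ a) (hp : 0 ≤ p)
    (hβ : β = 2 * (1 - ε) * (a₀ / (p + 1 + 2 * m)))
    (hΔ : IsGreatest (Set.range fun x : α => f {x}) Δ) {K N i : ℕ} {s : SearchState α}
    (hK : (Fintype.card α : ℝ) ≤ (1 + ε) ^ K)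
    (hs : SearchInv f I c p a ε β Δ K N i s) (hgap : s.hi ≤ s.lo + 1) {out : Finset α × Bool}
    (hout : SGSOutput f I c p a ε (β * Δ * (1 + ε) ^ s.lo) out) {V : ℝ}
    (hV : ∀ S ∈ out.1 :: s.found, f S ≤ V) {T : Finset α} (hT : IsFeasible I c T) :
    (1 - ε) * a₀ * f T ≤ (1 + ε) * ((p + 1 + 2 * m) * V) := by
  have hm : (0 : ℝ) ≤ m := Nat.cast_nonneg m
  have hΔx : ∀ x, f {x} ≤ Δ := fun x => hΔ.2 ⟨x, rfl⟩
  have hΔ0 : 0 ≤ Δ := (h0 _).trans (hΔx (Classical.arbitrary α))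
  have hoV : f out.1 ≤ V := hV _ (by simp)
  have hV0 : 0 ≤ V := (h0 _).trans hoV
  have hΔV : Δ ≤ V := by
    obtain ⟨x, hx⟩ := hΔ.1
    exact hx ▸ (hout.singleton_le x).trans hoV
  have hQV : V ≤ (p + 1 + 2 * m) * V := le_mul_of_one_le_left hV0 (by linarith)
  have hQV' : (p + 1 + 2 * m) * V ≤ (1 + ε) * ((p + 1 + 2 * m) * V) :=
    le_mul_of_one_le_left (hV0.trans hQV) (by linarith)
  rcases le_or_gt (f T) V with hTV | hTV
  · have h1 : (1 - ε) * a₀ ≤ 1 := mul_le_one₀ (by linarith) ha0 ha1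
    exact (mul_le_of_le_one_left (h0 T) h1).trans (hTV.trans (hQV.trans hQV'))
  have hTn : f T ≤ Δ * (1 + ε) ^ K := by
    rcases hf.le_empty_or_le_card_mul h0 hΔx T with h | h
    · exact absurd (h.trans (hout.empty_le.trans hoV)) (not_le.2 hTV)
    · rw [mul_comm] at h
      exact h.trans (mul_le_mul_of_nonneg_left hK hΔ0)
  have hpε : 0 ≤ (p + 1) / (1 - ε) := div_nonneg (by linarith) (by linarith)
  have reject : ∀ S ∈ out.1 :: s.found, ∀ i, β * Δ * (1 + ε) ^ i ≤ 2 * f S →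
      f T ≤ Δ * (1 + ε) ^ (i + 1) →
      (1 - ε) * a₀ * f T ≤ (1 + ε) * ((p + 1 + 2 * m) * V) := by
    intro S hS i hi hTi
    refine le_of_reject hε1 ha0 hε0.le hp hm (t := Δ * (1 + ε) ^ i)
      (hTi.trans_eq (by ring)) ?_
    rw [← hβ, ← mul_assoc]
    exact hi.trans (mul_le_mul_of_nonneg_left (hV S hS) (by norm_num))
  have notReject : ∀ S ∈ out.1 :: s.found, ∀ i,
      a * f T ≤ (p + 1) / (1 - ε) * f S + β * Δ * (1 + ε) ^ i * m →
      Δ * (1 + ε) ^ i ≤ (1 + ε) * f T →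
      (1 - ε) * a₀ * f T ≤ (1 + ε) * ((p + 1 + 2 * m) * V) := by
    intro S hS i hi hTi
    refine (le_of_not_reject hε1 ha0 ha hp hm (h0 T) hTi ?_).trans hQV'
    rw [← hβ, ← mul_assoc]
    exact hi.trans (add_le_add_left (mul_le_mul_of_nonneg_left (hV S hS) hpε) _)
  have hlo : (∃ S ∈ out.1 :: s.found, β * Δ * (1 + ε) ^ s.lo ≤ 2 * f S) ∨
      (s.lo = 1 ∧ out.2 = false) := by
    rcases hs.lo_spec with h | ⟨S, hS, h⟩
    · cases hb : out.2 with
      | true => exact Or.inl ⟨out.1, by simp, hout.of_reject hb⟩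
      | false => exact Or.inr ⟨h, rfl⟩
    · exact Or.inl ⟨S, List.mem_cons_of_mem _ hS, h⟩
  rcases hlo with ⟨S, hS, h⟩ | ⟨h1, hb⟩
  · rcases le_or_gt (f T) (Δ * (1 + ε) ^ (s.lo + 1)) with hle | hlt
    · exact reject S hS _ h hle
    · have h2 : Δ * (1 + ε) ^ s.hi < f T := lt_of_le_of_lt
        (mul_le_mul_of_nonneg_left (pow_le_pow_right₀ (by linarith) hgap) hΔ0) hlt
      rcases hs.hi_spec with h3 | ⟨S', hS', h3⟩
      · rw [h3] at h2
        exact absurd hTn (not_le.2 h2)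
      · refine notReject S' (List.mem_cons_of_mem _ hS') _ (h3 T hT) (h2.le.trans ?_)
        exact le_mul_of_one_le_left (h0 T) (by linarith)
  · refine notReject out.1 (by simp) s.lo (hout.of_not_reject hb T hT) ?_
    rw [h1, pow_one, mul_comm]
    exact mul_le_mul_of_nonneg_left (hΔV.trans hTV.le) (by linarith)

/-- The budget of a binary search among `K` exponents in at most `N` rounds, each with one run of
budget `b`, and with one final run. -/
def searchBudget (n K N : ℕ) (b : ℕ × ℕ × ℕ) : ℕ × ℕ × ℕ :=
  (N + 1) • (b + (0, 0, K + 4)) + (n + N + 1, 0, n + N + 1)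

theorem densitySearchSGS_ensures [Nonempty α] (hf : IsSubmodular f) (h0 : ∀ S, 0 ≤ f S)
    (hI : IsExtendible k I) (hc : ∀ r x, 0 ≤ c r x) (hsing : ∀ x : α, IsFeasible I c {x})
    (hε0 : 0 < ε) (hε1 : ε < 1) (hℓ : 0 < ℓ)
    (hcov : ∀ (T : Finset α) (S : Fin ℓ → Finset α),
      (∀ j j', j ≠ j' → Disjoint (S j) (S j')) → ℓ * (a * f T) ≤ ∑ j, f (T ∪ S j))
    (ha0 : 0 ≤ a₀) (ha1 : a₀ ≤ 1) (ha : a₀ ≤ a)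
    (hβ : β = 2 * (1 - ε) * (a₀ / ((max k (ℓ - 1) : ℕ) + 1 + 2 * m)))
    (hP : (1 - ε) ^ P ≤ ε / Fintype.card α)
    {pairs : List (α × Fin ℓ)} (hpairs : ∀ p, p ∈ pairs) {K : ℕ}
    (hK : ⌈Real.logb 2 (Fintype.card α : ℝ) / ε⌉₊ = K) {fuel : ℕ}
    (hfuel : max P (Nat.clog 2 K) < fuel) :
    Prog.Ensures f I (densitySearchSGS c pairs ε ε β fuel)
      (fun S => IsFeasible I c S ∧ ∀ T, IsFeasible I c T →
        (1 - ε) * a₀ * f T ≤ (1 + ε) * (((max k (ℓ - 1) : ℕ) + 1 + 2 * m) * f S))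
      (searchBudget (Fintype.card α) K (Nat.clog 2 K)
        (sgsBudget (Fintype.card α) m ℓ P pairs.length)) := by
  obtain ⟨x₀, hx₀⟩ := Finite.exists_max fun x : α => f {x}
  obtain ⟨Δ, hΔdef⟩ : ∃ Δ, Δ = f {x₀} := ⟨_, rfl⟩
  have hΔ : IsGreatest (Set.range fun x : α => f {x}) Δ := by
    rw [hΔdef]
    exact ⟨⟨x₀, rfl⟩, by rintro _ ⟨x, rfl⟩; exact hx₀ x⟩
  have hΔ0 : 0 ≤ Δ := hΔdef ▸ h0 _
  have hn1 : (1 : ℝ) ≤ Fintype.card α := by exact_mod_cast Fintype.card_pos (α := α)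
  have hKn : (Fintype.card α : ℝ) ≤ (1 + ε) ^ K :=
    hK ▸ le_one_add_pow_ceil_logb_div hn1 hε0 hε1.le
  have hβ0 : 0 ≤ β := by
    rw [hβ]
    exact mul_nonneg (by linarith) (div_nonneg ha0 (by positivity))
  have hsgs : ∀ i, Prog.Ensures f I (knapsackSGS c pairs (β * Δ * (1 + ε) ^ i) ε fuel)
      (SGSOutput f I c (max k (ℓ - 1) : ℕ) a ε (β * Δ * (1 + ε) ^ i))
      (sgsBudget (Fintype.card α) m ℓ P pairs.length) := fun i =>
    knapsackSGS_ensures hf h0 hI hc hsing (by positivity) hε0 hε1 hℓ hcov hΔ hP hpairs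
      (lt_of_le_of_lt (le_max_left _ _) hfuel)
  obtain ⟨b, hb⟩ : ∃ b, b = sgsBudget (Fintype.card α) m ℓ P pairs.length := ⟨_, rfl⟩
  rw [← hb] at hsgs ⊢
  obtain ⟨N, hN⟩ : ∃ N, N = Nat.clog 2 K := ⟨_, rfl⟩
  rw [← hN]
  unfold densitySearchSGS
  rw [hK]
  refine Prog.Ensures.mono (Prog.Ensures.bind
    (b' := N • ((0, 0, 0) + ((0, 0, K + 3) + b)) + (0, 0, 0) +
      ((0, 0, K + 4) + (b + (N + 1, 0, N + 1))))
    (Prog.maxSingleton_ensures (by simp) hΔ) fun Δ' hΔ' => ?_) (fun _ h => h) ?_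
  · subst hΔ'
    refine Prog.Ensures.bind (R := fun s : SearchState α =>
        ∃ i, SearchInv f I c (max k (ℓ - 1) : ℕ) a ε β Δ' K N i s ∧ s.hi ≤ s.lo + 1)
      (Prog.Ensures.whileLoop
        (test := fun s => decide (1 < |(s.hi : ℤ) - (s.lo : ℤ)|))
        (Inv := SearchInv f I c (max k (ℓ - 1) : ℕ) a ε β Δ' K N)
        (i := N) ?_ ?_ ?_ ?_ (lt_of_le_of_lt (hN ▸ le_max_right _ _) hfuel)) ?_
    · exact fun s => Prog.Ensures.ret
        (R := fun t => t = decide (1 < |(s.hi : ℤ) - (s.lo : ℤ)|)) rfl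
    · intro i s hs htest
      have hgap : s.lo + 1 < s.hi := by
        have h1 := of_decide_eq_true htest
        have h2 := hs.lo_le
        rw [lt_abs] at h1
        omega
      -- The number of rounds left is positive, as `⌈log₂⌉` of the gap bounds it from below.
      obtain ⟨i, rfl⟩ : ∃ i', i = i' + 1 := by
        have h1 := hs.clog_le
        rw [Nat.clog_of_two_le (by norm_num) (by omega)] at h1
        exact ⟨i - 1, by omega⟩
      refine ⟨i, rfl, Prog.Ensures.mono (Prog.Ensures.otherOps (Prog.Ensures.bind (b' := 0)
        (hsgs _) fun out hout => ?_)) (fun _ h => h) ?_⟩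
      · obtain ⟨i', hi', hs'⟩ := hs.step hgap hout
        obtain rfl : i = i' := by omega
        split_ifs at hs' ⊢ <;> exact Prog.Ensures.ret hs'
      · have h2 := hs.hi_le
        simp only [Prod.le_def, Prod.fst_add, Prod.snd_add, Prod.fst_zero, Prod.snd_zero]
        omega
    · intro i s hs htest
      have h1 := of_decide_eq_false htest
      rw [lt_abs, not_or] at h1
      exact ⟨i, hs, by omega⟩
    · refine ⟨?_, le_rfl, ?_, by simp, by simp, Or.inl rfl, Or.inl rfl⟩
      · -- If `n = 1` then `K = 0` and the lower end exceeds the upper one by one.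
        dsimp only; omega
      · rw [hN]; exact Nat.clog_mono_right 2 (Nat.sub_le _ _)
    · rintro s ⟨i, hs, hgap⟩
      refine Prog.Ensures.mono (Prog.Ensures.otherOps (Prog.Ensures.bind
        (b' := (s.found.length + 1, 0, s.found.length + 1)) (hsgs _) fun out hout => ?_))
        (fun _ h => h) ?_
      · refine (Prog.argmax_ensures (List.cons_ne_nil _ _)).mono (fun S hS => ⟨?_, ?_⟩) le_rfl
        · rcases List.mem_cons.1 hS.1 with rfl | h
          · exact hout.feasible
          · exact hs.feasible S h
        · exact fun T hT => hs.le_of_exit hf h0 hε0 hε1 ha0 ha1 ha (Nat.cast_nonneg _) hβ hΔ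
            hKn hgap hout hS.2 hT
      · have h2 := hs.hi_le
        have h3 := hs.lo_le
        have h4 := hs.length
        simp only [Prod.le_def, Prod.fst_add, Prod.snd_add]
        omega
  · obtain ⟨b₁, b₂, b₃⟩ := b
    simp only [searchBudget, Prod.le_def, Finset.length_toList, Finset.card_univ, Prod.smul_mk,
      smul_eq_mul, Prod.mk_add_mk]
    refine ⟨?_, ?_, ?_⟩ <;> ring_nf <;> omega

theorem densitySearchSGS_runLE {pairs : List (α × Fin ℓ)} {fuel fuel' : ℕ} (h : fuel ≤ fuel') :
    Prog.RunLE f I (densitySearchSGS c pairs ε ε β fuel)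
      (densitySearchSGS c pairs ε ε β fuel') :=
  Prog.RunLE.bind (.refl _) fun _ => Prog.RunLE.bind
    (Prog.RunLE.whileLoop (fun _ => Prog.RunLE.otherOps _
      (Prog.RunLE.bind (knapsackSGS_runLE h) fun _ => .refl _)) h _)
    fun _ => Prog.RunLE.otherOps _ (Prog.RunLE.bind (knapsackSGS_runLE h) fun _ => .refl _)

end Search

/-! ### Costs -/

section Costs

variable {ε : ℝ} {n : ℕ}

theorem half_le_log_div (hn : 1 ≤ n) (hε0 : 0 < ε) (hε1 : ε < 1 / 2) :
    1 / 2 ≤ Real.log (n / ε) := by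
  have h1 : (2 : ℝ) ≤ n / ε := by
    rw [le_div_iff₀ hε0]
    have : (1 : ℝ) ≤ n := by exact_mod_cast hn
    linarith
  have h2 := Real.log_le_log (by norm_num) h1
  linarith [Real.log_two_gt_d9]

theorem one_sub_pow_ceil_le (hn : 1 ≤ n) (hε0 : 0 < ε) (hε1 : ε ≤ 1) :
    (1 - ε) ^ ⌈Real.log (n / ε) / ε⌉₊ ≤ ε / n := by
  have hn' : (0 : ℝ) < n := by exact_mod_cast hn
  calc (1 - ε) ^ ⌈Real.log (n / ε) / ε⌉₊
      ≤ Real.exp (-ε) ^ ⌈Real.log (n / ε) / ε⌉₊ :=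
        pow_le_pow_left₀ (by linarith) (Real.one_sub_le_exp_neg ε) _
    _ = Real.exp (-(⌈Real.log (n / ε) / ε⌉₊ * ε)) := by
        rw [← Real.exp_nat_mul]
        congr 1
        ring
    _ ≤ Real.exp (-Real.log (n / ε)) := by
        refine Real.exp_le_exp.2 (neg_le_neg ?_)
        rw [← div_le_iff₀ hε0]
        exact Nat.le_ceil _
    _ = ε / n := by
        rw [Real.exp_neg, Real.exp_log (by positivity), inv_div]

theorem ceil_logb_div_le (hn : 1 ≤ n) (hε0 : 0 < ε) (hε1 : ε ≤ 1) :
    (⌈Real.logb 2 n / ε⌉₊ : ℝ) ≤ 2 * (n / ε) := by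
  have hn' : (1 : ℝ) ≤ n := by exact_mod_cast hn
  have h1 : Real.logb 2 n ≤ n := by
    rw [Real.logb_le_iff_le_rpow (by norm_num) (by linarith), Real.rpow_natCast]
    exact_mod_cast Nat.lt_two_pow_self.le
  have h2 : (1 : ℝ) ≤ n / ε := by
    rw [le_div_iff₀ hε0]
    linarith
  have h3 := (Nat.ceil_lt_add_one
    (div_nonneg (Real.logb_nonneg (by norm_num : (1 : ℝ) < 2) hn') hε0.le)).le
  have h4 := div_le_div_of_nonneg_right h1 hε0.le
  linarith

theorem clog_add_one_le (hn : 1 ≤ n) (hε0 : 0 < ε) (hε1 : ε < 1 / 2) {K : ℕ}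
    (hK : (K : ℝ) ≤ 2 * (n / ε)) : (Nat.clog 2 K : ℝ) + 1 ≤ 8 * Real.log (n / ε) := by
  have hL := half_le_log_div hn hε0 hε1
  rcases Nat.lt_or_ge K 2 with h | h
  · rw [Nat.clog_of_right_le_one (by omega)]
    norm_num
    linarith
  · have h1 := Nat.pow_pred_clog_lt_self (b := 2) (by norm_num) (x := K) (by omega)
    have h2 : (2 : ℝ) ^ (Nat.clog 2 K).pred ≤ 2 * (n / ε) :=
      le_trans (by exact_mod_cast h1.le) hK
    have hn' : (0 : ℝ) < n := by exact_mod_cast hn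
    have h3 := Real.log_le_log (by positivity) h2
    rw [Real.log_pow, Real.log_mul (by norm_num) (by positivity)] at h3
    have h4 : (Nat.clog 2 K : ℝ) ≤ (Nat.clog 2 K).pred + 1 := by
      exact_mod_cast (by rw [Nat.pred_eq_sub_one]; omega)
    have h5 := Real.log_two_gt_d9
    have h6 := Real.log_two_lt_d9
    have h7 : ((Nat.clog 2 K).pred : ℝ) * 0.69 ≤ (Nat.clog 2 K).pred * Real.log 2 :=
      mul_le_mul_of_nonneg_left (by linarith) (Nat.cast_nonneg _)
    linarith

theorem one_le_numM {k m : ℕ} (hk : 1 ≤ k) : 1 ≤ numM k m := hk.trans (le_max_right _ _)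

/-- Each of the `O(log (n / ε))` runs makes `O(log (n / ε) / ε)` passes over at most `n * ℓ` pairs. -/
theorem costBound_of_spent_le {k m ℓ N : ℕ} (hn : 1 ≤ n) (hk : 1 ≤ k) (hℓ : ℓ ≤ numM k m + 1)
    (hN : N ≤ n * ℓ) (hε0 : 0 < ε) (hε1 : ε < 1 / 2) {q : Cost}
    (hq : q.spent ≤ searchBudget n ⌈Real.logb 2 n / ε⌉₊ (Nat.clog 2 ⌈Real.logb 2 n / ε⌉₊)
      (sgsBudget n m ℓ ⌈Real.log (n / ε) / ε⌉₊ N)) : CostBound 500 2 n k m ε q := by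
  have hL := half_le_log_div hn hε0 hε1
  have hK := ceil_logb_div_le hn hε0 (by linarith)
  have hR := clog_add_one_le hn hε0 hε1 hK
  have hM : (1 : ℝ) ≤ numM k m := by exact_mod_cast one_le_numM hk
  have hn' : (1 : ℝ) ≤ n := by exact_mod_cast hn
  have hℓ' : (ℓ : ℝ) ≤ 2 * numM k m := by
    have : (ℓ : ℝ) ≤ numM k m + 1 := by exact_mod_cast hℓ
    linarith
  unfold CostBound
  set L : ℝ := Real.log (n / ε)
  have hLε : 1 ≤ L / ε := by
    rw [le_div_iff₀ hε0]
    linarith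
  have hP : (⌈L / ε⌉₊ : ℝ) ≤ 2 * (L / ε) := by
    linarith [(Nat.ceil_lt_add_one (zero_le_one.trans hLε)).le]
  generalize ⌈L / ε⌉₊ = P at hP hq
  generalize Nat.clog 2 ⌈Real.logb 2 n / ε⌉₊ = R at hR hq
  generalize ⌈Real.logb 2 n / ε⌉₊ = K at hK hq
  generalize numM k m = M at hM hℓ' ⊢
  obtain ⟨W, hW⟩ : ∃ W : ℝ, W = L * (M * n / ε) := ⟨_, rfl⟩
  have hW' : W = M * n * (L / ε) := by rw [hW]; ring
  have hMn : 1 ≤ (M : ℝ) * n := one_le_mul_of_one_le_of_one_le hM hn'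
  have hLW : L / ε ≤ W := hW' ▸ le_mul_of_one_le_left (by linarith) hMn
  have hMW : (M : ℝ) ≤ W := hW' ▸
    (le_mul_of_one_le_right (by linarith) hn').trans
      (le_mul_of_one_le_right (by linarith) hLε)
  have hnW : (n : ℝ) ≤ W := hW' ▸
    (le_mul_of_one_le_left (by linarith) hM).trans
      (le_mul_of_one_le_right (by linarith) hLε)
  have hKW : (K : ℝ) ≤ 4 * W := by
    have h1 : (n : ℝ) / ε ≤ M * n / ε :=
      div_le_div_of_nonneg_right (le_mul_of_one_le_left (by linarith) hM) hε0.le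
    have h2 : 1 / 2 * (M * n / ε) ≤ W := hW ▸ mul_le_mul_of_nonneg_right hL (by positivity)
    linarith
  have hPN : (P : ℝ) * N ≤ 4 * W := by
    have h1 : (N : ℝ) ≤ n * (2 * M) :=
      le_trans (by exact_mod_cast hN) (mul_le_mul_of_nonneg_left hℓ' (by linarith))
    calc (P : ℝ) * N ≤ 2 * (L / ε) * (n * (2 * M)) :=
          mul_le_mul hP h1 (Nat.cast_nonneg _) (by linarith)
      _ = 4 * W := by rw [hW']; ring
  have hW1 : 1 ≤ W := hM.trans hMW
  have hWL : W ≤ 2 * (L * W) := by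
    have := mul_le_mul_of_nonneg_right hL (by linarith : 0 ≤ W)
    linarith
  have hLLW : L ≤ L * W := le_mul_of_one_le_right (by linarith) hW1
  have hm0 : (0 : ℝ) ≤ m := Nat.cast_nonneg m
  have hLW0 : 0 ≤ L * W := by linarith
  simp only [searchBudget, sgsBudget, Prod.le_def, Cost.spent, Prod.smul_mk, smul_eq_mul,
    Prod.mk_add_mk] at hq
  obtain ⟨h1, h2, h3⟩ := hq
  have h1' : (q.oracle : ℝ) ≤ (R + 1) * (2 * n + ℓ + 3 * (P * N)) + (n + R + 1) := by
    exact_mod_cast h1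
  have h2' : (q.knap : ℝ) ≤ (R + 1) * (4 * m * (P * N)) := by
    exact_mod_cast h2
  have h3' : (q.other : ℝ) ≤
      (R + 1) * (2 * n + ℓ + (3 * (P * N) + 5 * P) + 3 + (K + 4)) + (n + R + 1) := by
    refine (Nat.cast_le.2 h3).trans (le_of_eq ?_)
    push_cast
    ring
  have hround : ∀ x y : ℝ, 0 ≤ y → x ≤ y * W → ((R : ℝ) + 1) * x ≤ 8 * y * (L * W) := by
    intro x y hy hx
    calc ((R : ℝ) + 1) * x ≤ (R + 1) * (y * W) := by gcongr
      _ ≤ 8 * L * (y * W) := mul_le_mul_of_nonneg_right hR (by positivity)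
      _ = _ := by ring
  have g1 := hround (2 * n + ℓ + 3 * (P * N)) 16 (by norm_num) (by linarith)
  have g2 := hround (4 * m * (P * N)) (16 * m) (by positivity)
    (by linarith [mul_le_mul_of_nonneg_left hPN (by positivity : (0 : ℝ) ≤ 4 * m)])
  have g3 := hround (2 * n + ℓ + (3 * (P * N) + 5 * P) + 3 + (K + 4)) 37 (by norm_num)
    (by linarith)
  have e1 : L ^ 2 * ((M : ℝ) * n / ε) = L * W := by rw [hW]; ring
  have e2 : L ^ 2 * ((M : ℝ) * m * n / ε) = m * (L * W) := by rw [hW]; ring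
  have e3 : L ^ 2 * ((M : ℝ) * (max m 1 : ℕ) * n / ε) = (max m 1 : ℕ) * (L * W) := by
    rw [hW]; ring
  rw [mul_assoc 500, mul_assoc 500, mul_assoc 500, e1, e2, e3]
  refine ⟨by linarith, ?_, ?_⟩
  · have : 0 ≤ m * (L * W) := mul_nonneg hm0 hLW0
    linarith
  · have hm1 : (m : ℝ) ≤ (max m 1 : ℕ) := by exact_mod_cast le_max_left m 1
    have hm2 : (1 : ℝ) ≤ (max m 1 : ℕ) := by exact_mod_cast le_max_right m 1
    have i1 := mul_le_mul_of_nonneg_right hm1 hLW0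
    have i2 := mul_le_mul_of_nonneg_right hm2 hLW0
    have i3 : (q.arith : ℝ) = q.knap + q.other := by simp [Cost.arith]
    rw [i3]
    linarith

end Costs

/-! ### Approximation ratios -/

theorem max_sub_one_cast {k ℓ : ℕ} (hℓ : 1 ≤ ℓ) :
    max (k : ℝ) ((ℓ : ℝ) - 1) = ((max k (ℓ - 1) : ℕ) : ℝ) := by
  rw [Nat.cast_max, Nat.cast_sub hℓ, Nat.cast_one]

/-- If `M` is not `k`, then it is `√(2 m + 1)` rounded up, so that `M ≤ √(2 m + 1) + 1` and
`(2 m + 1) / M ≤ √(2 m + 1)`. -/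
theorem numM_add_div_le (k m : ℕ) :
    (numM k m : ℝ) + (2 * (m : ℝ) + 1) / numM k m ≤
      max ((k : ℝ) + (2 * (m : ℝ) + 1) / k) (1 + 2 * Real.sqrt (2 * (m : ℝ) + 1)) := by
  unfold numM
  rcases max_choice ⌈Real.sqrt (1 + 2 * (m : ℝ))⌉₊ k with h | h
  · rw [h]
    refine le_trans ?_ (le_max_right _ _)
    rw [add_comm (1 : ℝ) (2 * (m : ℝ))]
    have h0 : 0 < Real.sqrt (2 * (m : ℝ) + 1) := Real.sqrt_pos.2 (by positivity)
    have h1 := Nat.le_ceil (Real.sqrt (2 * (m : ℝ) + 1))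
    have h2 := (Nat.ceil_lt_add_one h0.le).le
    have h3 : (2 * (m : ℝ) + 1) / ⌈Real.sqrt (2 * (m : ℝ) + 1)⌉₊ ≤
        Real.sqrt (2 * (m : ℝ) + 1) := by
      rw [div_le_iff₀ (h0.trans_le h1)]
      calc 2 * (m : ℝ) + 1 = Real.sqrt (2 * (m : ℝ) + 1) * Real.sqrt (2 * (m : ℝ) + 1) :=
            (Real.mul_self_sqrt (by positivity)).symm
        _ ≤ _ := mul_le_mul_of_nonneg_left h1 h0.le
    linarith
  · rw [h]
    exact le_max_left _ _

theorem ratio_general {k m : ℕ} {ε x y : ℝ} (hk : 1 ≤ k) (hε0 : 0 < ε) (hε1 : ε < 1 / 2)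
    (hx : 0 ≤ x) (hy : 0 ≤ y)
    (h : (1 - ε) * (1 - 1 / ((numM k m + 1 : ℕ) : ℝ) - ε) * x ≤
      (1 + ε) * ((numM k m + 1 + 2 * m) * y)) :
    x ≤ ((1 - 2 * ε) ^ 3)⁻¹ *
      (max ((k : ℝ) + (2 * (m : ℝ) + 1) / k) (1 + 2 * Real.sqrt (2 * (m : ℝ) + 1))
        + 2 * (m : ℝ) + 2) * y := by
  have hG := numM_add_div_le k m
  have hM : (1 : ℝ) ≤ numM k m := by exact_mod_cast one_le_numM (m := m) hk
  generalize max ((k : ℝ) + (2 * (m : ℝ) + 1) / k) (1 + 2 * Real.sqrt (2 * (m : ℝ) + 1)) = G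
    at hG ⊢
  push_cast at h
  generalize (numM k m : ℝ) = M at hM h hG
  have hM0 : 0 < M := by linarith
  have h2ε : 0 < 1 - 2 * ε := by linarith
  -- As `M ≥ 1`, subtracting `ε` from `M / (M + 1)` costs a factor of at most `1 - 2 ε`.
  have h1 : (1 - 2 * ε) * M ≤ (1 - 1 / (M + 1) - ε) * (M + 1) := by
    have : (1 - 1 / (M + 1) - ε) * (M + 1) = M - ε * (M + 1) := by field_simp; ring
    rw [this]
    have := mul_le_mul_of_nonneg_left hM hε0.le
    linarith
  have h2 : (1 - ε) * ((1 - 2 * ε) * M) * x ≤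
      (1 + ε) * ((M + 1 + 2 * m) * (M + 1) * y) := by
    calc (1 - ε) * ((1 - 2 * ε) * M) * x
        ≤ (1 - ε) * ((1 - 1 / (M + 1) - ε) * (M + 1)) * x := by
          have : 0 ≤ 1 - ε := by linarith
          gcongr
      _ = (1 - ε) * (1 - 1 / (M + 1) - ε) * x * (M + 1) := by ring
      _ ≤ (1 + ε) * ((M + 1 + 2 * m) * y) * (M + 1) :=
          mul_le_mul_of_nonneg_right h (by linarith)
      _ = _ := by ring
  have h3 : (M + 1 + 2 * m) * (M + 1) ≤ M * (G + 2 * m + 2) := by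
    have h4 := mul_le_mul_of_nonneg_left hG hM0.le
    have h5 : M * (M + (2 * (m : ℝ) + 1) / M) = M * M + (2 * m + 1) := by field_simp
    linarith
  have h4 : (1 - ε) * (1 - 2 * ε) * x ≤ (1 + ε) * ((G + 2 * m + 2) * y) := by
    refine le_of_mul_le_mul_left ?_ hM0
    have h5 := mul_le_mul_of_nonneg_left (mul_le_mul_of_nonneg_right h3 hy)
      (by linarith : 0 ≤ 1 + ε)
    linarith
  have h5 : (1 - 2 * ε) ^ 2 * (1 + ε) ≤ 1 - ε := by
    have : ε ^ 2 ≤ (1 / 2) ^ 2 := pow_le_pow_left₀ hε0.le hε1.le 2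
    have := mul_le_mul_of_nonneg_left this hε0.le
    linarith
  have h6 := mul_le_mul_of_nonneg_right h5 (mul_nonneg h2ε.le hx)
  rw [mul_assoc, ← div_eq_inv_mul, le_div_iff₀ (by positivity)]
  refine le_of_mul_le_mul_left ?_ (by linarith : 0 < 1 + ε)
  linarith

theorem ratio_monotone {ε x y Q : ℝ} (hε0 : 0 < ε) (hε1 : ε < 1 / 2) (hx : 0 ≤ x)
    (h : (1 - ε) * (1 - ε) * x ≤ (1 + ε) * (Q * y)) : x ≤ ((1 - ε) ^ 3)⁻¹ * Q * y := by
  have h1ε : 0 < 1 - ε := by linarith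
  have h1 : (1 - ε) * (1 + ε) ≤ 1 := by linarith [sq_nonneg ε]
  have h2 := mul_le_mul_of_nonneg_right h1 (mul_nonneg (mul_nonneg h1ε.le h1ε.le) hx)
  rw [mul_assoc, ← div_eq_inv_mul, le_div_iff₀ (by positivity)]
  refine le_of_mul_le_mul_left ?_ (by linarith : 0 < 1 + ε)
  linarith

theorem densitySearchSGS_halts {α : Type u} [Fintype α] [DecidableEq α] [Nonempty α]
    {f : Finset α → ℝ} {I : Set (Finset α)} {k m ℓ : ℕ} {c : Fin m → α → ℝ} {ε a a₀ β : ℝ}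
    (h0 : ∀ S, 0 ≤ f S) (hf : IsSubmodular f) (hk : 1 ≤ k) (hI : IsExtendible k I)
    (hc : ∀ r x, 0 ≤ c r x) (hsing : ∀ x : α, IsFeasible I c {x})
    (hε0 : 0 < ε) (hε1 : ε < 1 / 2) (hℓ : 0 < ℓ) (hℓM : ℓ ≤ numM k m + 1)
    (hcov : ∀ (T : Finset α) (S : Fin ℓ → Finset α),
      (∀ j j', j ≠ j' → Disjoint (S j) (S j')) → ℓ * (a * f T) ≤ ∑ j, f (T ∪ S j))
    (ha0 : 0 ≤ a₀) (ha1 : a₀ ≤ 1) (ha : a₀ ≤ a)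
    (hβ : β = 2 * (1 - ε) * (a₀ / ((max k (ℓ - 1) : ℕ) + 1 + 2 * m)))
    {pairs : List (α × Fin ℓ)} (hnd : pairs.Nodup) (hpairs : ∀ p, p ∈ pairs) :
    ∃ (S : Finset α) (q : Cost), Prog.Halts f I (densitySearchSGS c pairs ε ε β) S q ∧
      CostBound 500 2 (Fintype.card α) k m ε q ∧ IsFeasible I c S ∧
      ∀ T, IsFeasible I c T →
        (1 - ε) * a₀ * f T ≤ (1 + ε) * (((max k (ℓ - 1) : ℕ) + 1 + 2 * m) * f S) := by
  have hn : 1 ≤ Fintype.card α := Fintype.card_pos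
  obtain ⟨S, q, h1, h2, h3⟩ := Prog.Ensures.halts
    (P := densitySearchSGS c pairs ε ε β) (fun fuel h => densitySearchSGS_runLE h)
    (densitySearchSGS_ensures hf h0 hI hc hsing hε0 (by linarith) hℓ hcov ha0 ha1 ha hβ
      (one_sub_pow_ceil_le hn hε0 (by linarith)) hpairs rfl (Nat.lt_succ_self _))
  refine ⟨S, q, h1, costBound_of_spent_le hn hk hℓM ?_ hε0 hε1 h3, h2⟩
  simpa using hnd.length_le_card

theorem mainTheorem10 :
    ∃ (C : ℝ) (d : ℕ),
      ∀ (α : Type*) [Fintype α] [DecidableEq α] [Nonempty α]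
        (f : Finset α → ℝ) (I : Set (Finset α)) (k m : ℕ) (c : Fin m → α → ℝ) (ε : ℝ),
        (∀ S, 0 ≤ f S) → IsSubmodular f →
        1 ≤ k → IsExtendible k I →
        (∀ r x, 0 ≤ c r x) → (∀ x : α, IsFeasible I c {x}) →
        0 < ε → ε < 1 / 2 →
        (∀ pairs : List (α × Fin (numM k m + 1)), pairs.Nodup → (∀ p, p ∈ pairs) →
          ∃ (S : Finset α) (q : Cost),
            Prog.Halts f I
              (densitySearchSGS c pairs ε ε (betaGeneral k m (numM k m + 1) ε)) S q ∧
            CostBound C d (Fintype.card α) k m ε q ∧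
            IsFeasible I c S ∧
            ∀ T : Finset α, IsFeasible I c T →
              f T ≤ ((1 - 2 * ε) ^ 3)⁻¹ *
                (max ((k : ℝ) + (2 * (m : ℝ) + 1) / k) (1 + 2 * Real.sqrt (2 * (m : ℝ) + 1))
                  + 2 * (m : ℝ) + 2) * f S) ∧
        (Monotone f → ∀ ℓ : ℕ, 1 ≤ ℓ → ℓ ≤ k + 1 →
          ∀ pairs : List (α × Fin ℓ), pairs.Nodup → (∀ p, p ∈ pairs) →
          ∃ (S : Finset α) (q : Cost),
            Prog.Halts f I (densitySearchSGS c pairs ε ε (betaMonotone k m ℓ ε)) S q ∧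
            CostBound C d (Fintype.card α) k m ε q ∧
            IsFeasible I c S ∧
            ∀ T : Finset α, IsFeasible I c T →
              f T ≤ ((1 - ε) ^ 3)⁻¹ * ((k : ℝ) + 2 * (m : ℝ) + 1) * f S) := by
  refine ⟨500, 2, fun α _ _ _ f I k m c ε h0 hf hk hI hc hsing hε0 hε1 =>
    ⟨fun pairs hnd hpairs => ?_, fun hmono ℓ hℓ1 hℓk pairs hnd hpairs => ?_⟩⟩
  · have hM : (1 : ℝ) ≤ numM k m := by exact_mod_cast one_le_numM (m := m) hk
    have hinv : 1 / ((numM k m + 1 : ℕ) : ℝ) ≤ 1 / 2 := by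
      refine one_div_le_one_div_of_le (by norm_num) ?_
      push_cast
      linarith
    have hinv0 : 0 ≤ 1 / ((numM k m + 1 : ℕ) : ℝ) := by positivity
    obtain ⟨S, q, h1, h2, h3, h4⟩ := densitySearchSGS_halts (ℓ := numM k m + 1)
      (β := betaGeneral k m (numM k m + 1) ε) (a := 1 - 1 / ((numM k m + 1 : ℕ) : ℝ))
      (a₀ := 1 - 1 / ((numM k m + 1 : ℕ) : ℝ) - ε)
      h0 hf hk hI hc hsing hε0 hε1 (Nat.succ_pos _) le_rfl
      (fun T S hS => by
        refine le_trans (le_of_eq ?_) (hf.le_sum_union h0 T S hS)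
        rw [Fintype.card_fin]
        field_simp)
      (by linarith) (by linarith) (by linarith)
      (by unfold betaGeneral; rw [max_sub_one_cast (Nat.le_add_left _ _)]) hnd hpairs
    refine ⟨S, q, h1, h2, h3, fun T hT => ratio_general hk hε0 hε1 (h0 T) (h0 S) ?_⟩
    have h5 := h4 T hT
    rwa [Nat.add_sub_cancel, max_eq_right (show k ≤ numM k m from le_max_right _ _)] at h5
  · obtain ⟨S, q, h1, h2, h3, h4⟩ := densitySearchSGS_halts (ℓ := ℓ)
      (β := betaMonotone k m ℓ ε) (a := 1) (a₀ := 1 - ε)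
      h0 hf hk hI hc hsing hε0 hε1 hℓ1
      (hℓk.trans (Nat.succ_le_succ (le_max_right _ _)))
      (fun T S _ => by
        simpa using Finset.card_nsmul_le_sum Finset.univ (fun j => f (T ∪ S j)) (f T)
          fun j _ => hmono Finset.subset_union_left)
      (by linarith) (by linarith) (by linarith)
      (by unfold betaMonotone; rw [max_sub_one_cast hℓ1]) hnd hpairs
    refine ⟨S, q, h1, h2, h3, fun T hT => ratio_monotone hε0 hε1 (h0 T) ?_⟩
    have h5 := h4 T hT
    rw [max_eq_left (by omega : ℓ - 1 ≤ k)] at h5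
    convert h5 using 3
    ring
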